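/- Let $p$ be a prime, $F=\mathbb F_{p^m}$, $N=p^l n$ with $l\ge 0$ and $\gcd(n,p)=1$, and put $s=p^l$. For a nonzero polynomial $h\in F[x]$ of degree $d$ let $h^*(x)=x^{d}h(1/x)$ be its reciprocal. Write, up to a nonzero scalar factor, $$x^n-1=f_1\cdots f_r\,f_{r+1}\cdots f_{r+w},$$ where for $1\le i\le r$ the polynomial $f_i$ is irreducible and $f_i^*$ equals $f_i$ up to a nonzero scalar, and for $r+1\le i\le r+w$ we have $f_i=g_ig_i^*$ with $g_i$ irreducible and $g_i^*$ not a scalar multiple of $g_i$; thus $x^N-1$ is, up to a scalar, $\prod_i f_i^{p^l}$. Let $S=F[x]/\langle x^N-1\rangle$, regarded as a subring of the group ring $F[D_{2N}]$, where $D_{2N}=\langle x,y\mid x^N=y^2=1,\ yx=x^{-1}y\rangle$. Let $$A_i=\langle (x^N-1)/f_i^{p^l}\rangle\ (1\le i\le r),\qquad A_{i_1}=\langle (x^N-1)/g_i^{p^l}\rangle,\quad A_{i_2}=\langle (x^N-1)/(g_i^*)^{p^l}\rangle\ (r+1\le i\le r+w),$$ which are ideals of $S$. The ideals $A_i$ ($1\le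 i\le r$), $A_{i_1}$ and $A_{i_2}$ ($r+1\le i\le r+w$) are chain rings with identity elements $E_i$, $E_{i_1}$, $E_{i_2}$, respectively. Their maximal ideals are generated by $\Gamma_i=E_if_i$, $\Gamma_{i_1}=E_{i_1}g_i$ and $\Gamma_{i_2}=E_{i_2}g_i^*$, respectively, and each of these generators has nilpotency index $s=p^l$. Zeroth powers of these generators are understood in the respective component rings: $\Gamma_i^0=E_i$, $\Gamma_{i_1}^0=E_{i_1}$, $\Gamma_{i_2}^0=E_{i_2}$. Every left ideal $C$ of $F[D_{2N}]$ is a direct sum $C=\bigoplus_{i=1}^{r+w}C_i$ of left ideals $C_i$ of $F[D_{2N}]$ of the following forms, where $\langle\cdot\rangle$ denotes the left ideal of $F[D_{2N}]$ that is generated. A) For $1\le i\le r$, $C_i$ has one of the forms - A1) $C_i=\langle \Gamma_i^{b}\rangle$ with $0\le b\le s$; - A2) $C_i=\langle \Gamma_i^{a}(y+r_i(x)),\ \Gamma_i^{b}\rangle$ with $0\le a<b\le s$ and $r_i(x)\in A_i$ such that $r_i(x)r_i(x^{-1})\equiv E_i \pmod{\Gamma_i^{\,b-a}}$. B) For $r+1\le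 i\le r+w$, $C_i$ has one of the forms - B1) $C_i=\langle \Gamma_{i_1}^{a}+\Gamma_{i_2}^{c}\rangle$ with $0\le a,c\le s$; - B2) $C_i=\langle (\Gamma_{i_1}^{a}+\Gamma_{i_2}^{c})+\Gamma_{i_1}^{b}\alpha(x)\,y\rangle$ with $0\le a\le s-1$, $1\le c\le s$, $\max\{0,a+c-s\}\le b\le c-1$ and $\alpha(x)\in A_{i_1}$ a unit of $A_{i_1}$ modulo $\Gamma_{i_1}^{\,c-b}$. Moreover, every left ideal of one of these forms, with parameters satisfying the stated conditions, has the following cardinality: $p^{2m\deg(f_i)(p^l-b)}$ in case A1, $p^{m\deg(f_i)(2p^l-(a+b))}$ in case A2, and $p^{2m\deg(g_i)(2p^l-a-c)}$ in cases B1 and B2. -/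

import Mathlib

open Polynomial

noncomputable section

namespace DihedralCode

/-- The cyclic ring `S = F[x] / (x ^ N - 1)`. -/
abbrev CyclicRing (F : Type*) [Field F] (N : ℕ) : Type _ :=
  F[X] ⧸ Ideal.span {(X ^ N - 1 : F[X])}

/-- The group ring `F[D_{2N}]`; its left ideals are the terms of type `Ideal (GroupRing F N)`. -/
abbrev GroupRing (F : Type*) [Field F] (N : ℕ) : Type _ :=
  MonoidAlgebra F (DihedralGroup N)

variable {F : Type*} [Field F] {N : ℕ}

/-- The class of a polynomial in `F[x] / (x ^ N - 1)`. -/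
def cls (N : ℕ) (h : F[X]) : CyclicRing F N :=
  Ideal.Quotient.mk (Ideal.span {(X ^ N - 1 : F[X])}) h

theorem cls_X_pow : (cls N (X : F[X])) ^ N = 1 := by
  have h : cls N (X ^ N - 1 : F[X]) = 0 :=
    Ideal.Quotient.eq_zero_iff_mem.mpr (Ideal.subset_span rfl)
  simp only [cls, map_sub, map_pow, map_one] at h
  exact sub_eq_zero.mp h

/-- An `F`-algebra map out of `F[x] / (x ^ N - 1)` sending `x` to an element `z` with `z ^ N = 1`. -/
def liftX {B : Type*} [Semiring B] [Algebra F B] (z : B) (hz : aeval z (X ^ N - 1 : F[X]) = 0) :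
    CyclicRing F N →ₐ[F] B :=
  Ideal.Quotient.liftₐ (Ideal.span {(X ^ N - 1 : F[X])}) (aeval z) (by
    intro a ha
    obtain ⟨c, rfl⟩ := Ideal.mem_span_singleton'.mp ha
    rw [map_mul, hz, mul_zero])

/-- The automorphism `a(x) ↦ a(x⁻¹)` of `F[x] / (x ^ N - 1)` (here `x⁻¹ = x ^ (N - 1)`). -/
def theta : CyclicRing F N →ₐ[F] CyclicRing F N :=
  liftX ((cls N (X : F[X])) ^ (N - 1)) (by
    rw [map_sub, map_pow, aeval_X, map_one, ← pow_mul, mul_comm, pow_mul, cls_X_pow, one_pow,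
      sub_self])

/-- The embedding of `F[x] / (x ^ N - 1)` in `F[D_{2N}]` that sends `x` to the rotation `x`. -/
def emb : CyclicRing F N →ₐ[F] GroupRing F N :=
  liftX (MonoidAlgebra.of F (DihedralGroup N) (DihedralGroup.r 1)) (by
    rw [map_sub, map_pow, aeval_X, map_one, ← map_pow, DihedralGroup.r_one_pow_n, map_one,
      sub_self])

/-- The reflection `y` in `F[D_{2N}]`; it satisfies `y ^ 2 = 1` and `y x = x⁻¹ y`. -/
def y : GroupRing F N := MonoidAlgebra.of F (DihedralGroup N) (DihedralGroup.sr 0)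

/-- For a divisor `h` of `x ^ N - 1`, the ideal of `F[x] / (x ^ N - 1)` generated by
`(x ^ N - 1) / h` (an exact division of polynomials). -/
def component (N : ℕ) (h : F[X]) : Ideal (CyclicRing F N) :=
  Ideal.span {cls N ((X ^ N - 1) / h)}

/-- The `k`-th power of `γ` in a ring with identity `e` that is an ideal of an ambient ring:
it is `e` for `k = 0`, and `γ ^ k` for `1 ≤ k` (since `e * γ = γ`). -/
def cpow {R : Type*} [CommRing R] (e γ : R) (k : ℕ) : R := e * γ ^ k

/-- The ideal `A` of `R`, as a ring in itself, is a chain ring with identity `e`, its maximal ideal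
is generated by `γ`, and the nilpotency index of `γ` is `s`. As `A` has the identity `e`, the ideals
of the ring `A` are the ideals of `R` that are contained in `A`. -/
structure IsChainComponent {R : Type*} [CommRing R] (A : Ideal R) (e γ : R) (s : ℕ) : Prop where
  identity_mem : e ∈ A
  identity_mul : ∀ a ∈ A, e * a = a
  chain : ∀ I J : Ideal R, I ≤ A → J ≤ A → I ≤ J ∨ J ≤ I
  maximal_lt : Ideal.span {γ} < A
  le_maximal : ∀ I : Ideal R, I < A → I ≤ Ideal.span {γ}
  nilpotency : ∀ k : ℕ, cpow e γ k = 0 ↔ s ≤ k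

/-- The left ideal `⟨γ ^ b⟩`. -/
def idealA1 (e γ : CyclicRing F N) (b : ℕ) : Ideal (GroupRing F N) :=
  Ideal.span {emb (cpow e γ b)}

/-- The left ideal `⟨γ ^ a (y + ρ), γ ^ b⟩`. -/
def idealA2 (e γ : CyclicRing F N) (a b : ℕ) (ρ : CyclicRing F N) : Ideal (GroupRing F N) :=
  Ideal.span {emb (cpow e γ a) * (y + emb ρ), emb (cpow e γ b)}

/-- `0 ≤ a < b ≤ s`, `ρ ∈ A` and `ρ(x) ρ(x⁻¹) = e mod γ ^ (b - a)`. -/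
structure ParamA2 (A : Ideal (CyclicRing F N)) (e γ : CyclicRing F N) (s a b : ℕ)
    (ρ : CyclicRing F N) : Prop where
  lt : a < b
  le : b ≤ s
  mem : ρ ∈ A
  norm_eq : ρ * theta ρ - e ∈ Ideal.span {cpow e γ (b - a)}

/-- The left ideal `⟨γ₁ ^ a + γ₂ ^ c⟩`. -/
def idealB1 (e₁ γ₁ e₂ γ₂ : CyclicRing F N) (a c : ℕ) : Ideal (GroupRing F N) :=
  Ideal.span {emb (cpow e₁ γ₁ a + cpow e₂ γ₂ c)}

/-- The left ideal `⟨(γ₁ ^ a + γ₂ ^ c) + (γ₁ ^ b α) y⟩`. -/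
def idealB2 (e₁ γ₁ e₂ γ₂ : CyclicRing F N) (a b c : ℕ) (α : CyclicRing F N) :
    Ideal (GroupRing F N) :=
  Ideal.span {emb (cpow e₁ γ₁ a + cpow e₂ γ₂ c) + emb (cpow e₁ γ₁ b * α) * y}

/-- `0 ≤ a ≤ s - 1`, `1 ≤ c ≤ s`, `max {0, a + c - s} ≤ b ≤ c - 1`, and `α ∈ A₁` is a unit of `A₁`
modulo `γ₁ ^ (c - b)`. -/
structure ParamB2 (A₁ : Ideal (CyclicRing F N)) (e₁ γ₁ : CyclicRing F N) (s a b c : ℕ)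
    (α : CyclicRing F N) : Prop where
  a_lt : a < s
  one_le : 1 ≤ c
  c_le : c ≤ s
  le_b : a + c ≤ b + s
  b_lt : b < c
  mem : α ∈ A₁
  unit : ∃ β ∈ A₁, α * β - e₁ ∈ Ideal.span {cpow e₁ γ₁ (c - b)}

end DihedralCode

end

/-!
The cyclic ring `S = F[x] / (x ^ N - 1)` splits, by the Chinese remainder theorem, into one component
for each irreducible factor `φ` of `x ^ n - 1`, with idempotent `e` equal to `1` modulo `φ ^ s` and to
`0` modulo the complementary factor (`IsPrimaryIdempotent`). Since `e p = 0` exactly when `φ ^ s`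
divides `p`, the component is a copy of `F[x] / (φ ^ s)`: a chain ring in which `Γ = e φ` generates
the maximal ideal and `Γ ^ k` generates an ideal of `|F| ^ (deg φ (s - k))` elements.

Every element of `F[D_{2N}]` is `a + b y` for a unique pair `(a, b)` in `S × S`, and left
multiplication by `y` is the map `(a, b) ↦ (b(x⁻¹), a(x⁻¹))`, called `twist`. So left ideals are the
`S`-submodules of `S × S` that are stable under `twist` (`pairs`). The involution `x ↦ x⁻¹` takes the
idempotent of `φ` to that of its reciprocal; hence the idempotents `E_i` and `E_{i1} + E_{i2}` are
central in the group ring, and every left ideal is the direct sum of its parts in the corresponding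
components (`exists_direct_sum`).

A submodule of `S × S` that lives over one chain ring is generated by the rows `(Γ ^ a, β)`,
`(0, Γ ^ c)` of a triangular matrix, and it then has as many elements as `⟨Γ ^ a⟩ × ⟨Γ ^ c⟩`
(`IsChainComponent.exists_submodule_eq`, `card_span_triangular`). In a self-reciprocal component,
stability under `twist` forces `a ≤ c`, `β = Γ ^ a ρ(x⁻¹)` and `ρ(x) ρ(x⁻¹) = E` modulo `Γ ^ (c - a)`,
which is the list A (`exists_eq_idealA2`; the case `a = c` is A1). In the component of two
reciprocal factors `twist` exchanges the two chain rings, so a left ideal is determined by its part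
over the first of them, which may be any submodule, and has the square of its cardinality; writing
`β` as a power of `Γ` times a unit gives the list B (`exists_eq_idealB`).
-/

noncomputable section

namespace DihedralCode

/-! ### Chain rings -/

section Chain

variable {R : Type*} [CommRing R] {A : Ideal R} {e γ : R} {s : ℕ}

theorem cpow_succ (e γ : R) (k : ℕ) : cpow e γ (k + 1) = cpow e γ k * γ := by
  simp only [cpow, pow_succ, mul_assoc]

theorem cpow_add (e γ : R) (j k : ℕ) : cpow e γ (j + k) = cpow e γ j * γ ^ k := by
  simp only [cpow, pow_add, mul_assoc]

theorem span_cpow_anti (e γ : R) {j k : ℕ} (h : j ≤ k) :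
    Ideal.span {cpow e γ k} ≤ Ideal.span {cpow e γ j} := by
  rw [Ideal.span_singleton_le_span_singleton]
  obtain ⟨t, rfl⟩ := Nat.exists_eq_add_of_le h
  exact ⟨γ ^ t, cpow_add e γ j t⟩

/-- Uniformizer times unit: if every element of `A` is either divisible by `γ` or a unit of `A`,
and `γ` is nilpotent, then every element of `A` is a power of `γ` times a unit of `A`. -/
theorem exists_eq_cpow_mul_unit (he : e ∈ A) (hid : ∀ a ∈ A, e * a = a)
    (hdich : ∀ x ∈ A, x ∈ Ideal.span {γ} ∨ ∃ v ∈ A, x * v = e) (hs : cpow e γ s = 0)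
    {x : R} (hx : x ∈ A) :
    ∃ k ≤ s, ∃ u ∈ A, ∃ v ∈ A, u * v = e ∧ x = cpow e γ k * u := by
  have key : ∀ t, (∃ k ≤ t, ∃ u ∈ A, ∃ v ∈ A, u * v = e ∧ x = cpow e γ k * u) ∨
      ∃ u ∈ A, x = cpow e γ t * u := by
    intro t
    induction t with
    | zero => exact Or.inr ⟨x, hx, by simp [cpow, hid x hx]⟩
    | succ t ih =>
      rcases ih with ⟨k, hk, h⟩ | ⟨u, hu, h⟩
      · exact Or.inl ⟨k, hk.trans t.le_succ, h⟩
      · rcases hdich u hu with hγ | ⟨v, hv, huv⟩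
        · obtain ⟨c, rfl⟩ := Ideal.mem_span_singleton'.mp hγ
          refine Or.inr ⟨e * c, A.mul_mem_right _ he, ?_⟩
          rw [h, cpow_succ]
          simp only [cpow]
          linear_combination (-γ ^ t * γ * c) * hid e he
        · exact Or.inl ⟨t, t.le_succ, u, hu, v, hv, huv, h⟩
  rcases key s with h | ⟨u, -, h⟩
  · exact h
  · exact ⟨s, le_rfl, e, he, e, he, hid e he, by rw [h, hs, zero_mul, zero_mul]⟩

/-- Under the hypotheses of `exists_eq_cpow_mul_unit` the powers of `γ` generate all ideals. -/
theorem exists_eq_span_cpow (he : e ∈ A) (hid : ∀ a ∈ A, e * a = a)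
    (hdich : ∀ x ∈ A, x ∈ Ideal.span {γ} ∨ ∃ v ∈ A, x * v = e) (hs : cpow e γ s = 0)
    {I : Ideal R} (hI : I ≤ A) : ∃ k ≤ s, I = Ideal.span {cpow e γ k} := by
  classical
  have hex : ∃ k, cpow e γ k ∈ I := ⟨s, by rw [hs]; exact I.zero_mem⟩
  refine ⟨Nat.find hex, Nat.find_min' hex (by rw [hs]; exact I.zero_mem), le_antisymm ?_ ?_⟩
  · intro x hx
    obtain ⟨k, -, u, -, v, -, huv, rfl⟩ := exists_eq_cpow_mul_unit he hid hdich hs (hI hx)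
    have hk : cpow e γ k ∈ I := by
      have h := I.mul_mem_right v hx
      rwa [mul_assoc, huv, mul_comm, cpow, ← mul_assoc, hid e he] at h
    exact Ideal.mul_mem_right _ _
      (span_cpow_anti e γ (Nat.find_min' hex hk) (Ideal.mem_span_singleton_self _))
  · rw [Ideal.span_singleton_le_iff_mem]
    exact Nat.find_spec hex

theorem isChainComponent_of_unit_or_dvd (he : e ∈ A) (hid : ∀ a ∈ A, e * a = a) (hγ : γ ∈ A)
    (hdich : ∀ x ∈ A, x ∈ Ideal.span {γ} ∨ ∃ v ∈ A, x * v = e)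
    (hs : ∀ k, cpow e γ k = 0 ↔ s ≤ k) (hs0 : 0 < s) : IsChainComponent A e γ s where
  identity_mem := he
  identity_mul := hid
  chain I J hI hJ := by
    obtain ⟨i, -, rfl⟩ := exists_eq_span_cpow he hid hdich ((hs s).mpr le_rfl) hI
    obtain ⟨j, -, rfl⟩ := exists_eq_span_cpow he hid hdich ((hs s).mpr le_rfl) hJ
    exact (le_total j i).imp (span_cpow_anti e γ) (span_cpow_anti e γ)
  maximal_lt := by
    have hle : Ideal.span {γ} ≤ A := by rwa [Ideal.span_singleton_le_iff_mem]
    refine lt_of_le_of_ne hle fun h => hs0.not_ge ((hs 0).mp ?_)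
    obtain ⟨c, hc⟩ := Ideal.mem_span_singleton'.mp (h ▸ he)
    have hpow : ∀ k, e = cpow e γ k * c ^ k := by
      intro k
      induction k with
      | zero => simp [cpow]
      | succ k ih =>
        have h2 : cpow e γ (k + 1) * c ^ (k + 1) = (cpow e γ k * c ^ k) * (c * γ) := by
          rw [cpow_succ, pow_succ]; ring
        rw [h2, ← ih, hc, hid e he]
    have := hpow s
    rw [(hs s).mpr le_rfl, zero_mul] at this
    simp [cpow, this]
  le_maximal I hI x hx := by
    rcases hdich x (hI.le hx) with h | ⟨v, -, hv⟩
    · exact h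
    · refine absurd (le_antisymm hI.le fun a ha => ?_) hI.ne
      rw [← hid a ha, ← hv]
      exact I.mul_mem_right _ (I.mul_mem_right _ hx)
  nilpotency := hs

namespace IsChainComponent

variable (h : IsChainComponent A e γ s)
include h

theorem identity_mul_self : e * e = e := h.identity_mul e h.identity_mem

theorem mem_iff {x : R} : x ∈ A ↔ e * x = x :=
  ⟨h.identity_mul x, fun hx => hx ▸ A.mul_mem_right _ h.identity_mem⟩

theorem unit_or_dvd (x : R) (hx : x ∈ A) : x ∈ Ideal.span {γ} ∨ ∃ v ∈ A, x * v = e := by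
  by_cases hlt : Ideal.span {x} = A
  · right
    obtain ⟨c, hc⟩ := Ideal.mem_span_singleton'.mp (hlt ▸ h.identity_mem)
    refine ⟨e * c, A.mul_mem_right _ h.identity_mem, ?_⟩
    linear_combination e * hc + h.identity_mul_self
  · left
    have hle : Ideal.span {x} ≤ A := by rwa [Ideal.span_singleton_le_iff_mem]
    exact h.le_maximal _ (lt_of_le_of_ne hle hlt) (Ideal.mem_span_singleton_self _)

theorem cpow_eq_zero : cpow e γ s = 0 := (h.nilpotency s).mpr le_rfl

theorem exists_unit {x : R} (hx : x ∈ A) :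
    ∃ k ≤ s, ∃ u ∈ A, ∃ v ∈ A, u * v = e ∧ x = cpow e γ k * u :=
  exists_eq_cpow_mul_unit h.identity_mem h.identity_mul h.unit_or_dvd h.cpow_eq_zero hx

theorem exists_span {I : Ideal R} (hI : I ≤ A) : ∃ k ≤ s, I = Ideal.span {cpow e γ k} :=
  exists_eq_span_cpow h.identity_mem h.identity_mul h.unit_or_dvd h.cpow_eq_zero hI

theorem identity_mul_cpow (k : ℕ) : e * cpow e γ k = cpow e γ k := by
  rw [cpow, ← mul_assoc, h.identity_mul_self]

theorem cpow_mul_identity (k : ℕ) : cpow e γ k * e = cpow e γ k := by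
  rw [mul_comm, h.identity_mul_cpow]

theorem cpow_mul_cpow (j k : ℕ) : cpow e γ j * cpow e γ k = cpow e γ (j + k) := by
  rw [cpow_add]
  conv_lhs => rw [cpow.eq_def e γ k, ← mul_assoc, h.cpow_mul_identity]

theorem le_of_cpow_mem {j k : ℕ} (hk : k ≤ s) (hj : cpow e γ j ∈ Ideal.span {cpow e γ k}) :
    k ≤ j := by
  by_contra! hlt
  obtain ⟨c, hc⟩ := Ideal.mem_span_singleton'.mp hj
  -- multiplication by the power of `γ` that raises `j` to `s - 1` raises `k` to `s` at least
  have h0 : cpow e γ (s - 1) = 0 := by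
    have h1 : cpow e γ (s - 1) = c * cpow e γ (k + (s - 1 - j)) := by
      rw [cpow_add, ← mul_assoc, hc, ← cpow_add]
      congr 1; omega
    rw [h1, (h.nilpotency _).mpr (by omega), mul_zero]
  have := (h.nilpotency _).mp h0
  omega

/-- Cancellation of a power of `γ`. -/
theorem mem_span_of_cpow_mul_mem {a b : ℕ} (hb : b ≤ s) {x : R} (hx : x ∈ A)
    (hm : cpow e γ a * x ∈ Ideal.span {cpow e γ b}) : x ∈ Ideal.span {cpow e γ (b - a)} := by
  obtain ⟨k, -, u, -, v, -, huv, rfl⟩ := h.exists_unit hx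
  have h1 : cpow e γ (a + k) ∈ Ideal.span {cpow e γ b} := by
    have h2 := Ideal.mul_mem_right v _ hm
    rwa [mul_assoc, mul_assoc, huv, h.cpow_mul_identity, h.cpow_mul_cpow] at h2
  have := h.le_of_cpow_mem hb h1
  exact Ideal.mul_mem_right _ _
    (span_cpow_anti e γ (by omega : b - a ≤ k) (Ideal.mem_span_singleton_self _))

/-- A submodule of `R × R` on which `e` acts as the identity is generated by the rows of an upper
triangular `2 × 2` matrix over the chain ring. -/
theorem exists_submodule_eq {M : Submodule R (R × R)} (hM : ∀ v ∈ M, e • v = v) :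
    ∃ a ≤ s, ∃ c ≤ s, ∃ β ∈ A, M = Submodule.span R {(cpow e γ a, β), (0, cpow e γ c)} ∧
      ∀ x, x * cpow e γ a = 0 → x * β ∈ Ideal.span {cpow e γ c} := by
  have hmem : ∀ v ∈ M, v.1 ∈ A ∧ v.2 ∈ A := fun v hv => by
    have := hM v hv
    exact ⟨h.mem_iff.mpr (congrArg Prod.fst this), h.mem_iff.mpr (congrArg Prod.snd this)⟩
  obtain ⟨a, ha, hPa⟩ := h.exists_span (I := M.map (LinearMap.fst R R R)) (by
    rintro _ ⟨v, hv, rfl⟩; exact (hmem v hv).1)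
  obtain ⟨c, hc, hPc⟩ := h.exists_span (I := M.comap (LinearMap.inr R R R)) (by
    intro x hx; exact (hmem _ hx).2)
  obtain ⟨⟨x, β⟩, hβ, hxa : x = _⟩ : cpow e γ a ∈ M.map (LinearMap.fst R R R) :=
    hPa ▸ Ideal.mem_span_singleton_self _
  subst hxa
  have hcM : ((0, cpow e γ c) : R × R) ∈ M := by
    have : cpow e γ c ∈ M.comap (LinearMap.inr R R R) :=
      hPc ▸ Ideal.mem_span_singleton_self _
    exact this
  refine ⟨a, ha, c, hc, β, (hmem _ hβ).2, le_antisymm ?_ ?_, ?_⟩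
  · rintro ⟨x, t⟩ hv
    obtain ⟨q, hq⟩ := Ideal.mem_span_singleton'.mp (hPa ▸ Submodule.mem_map_of_mem hv)
    have hq' : q * cpow e γ a = x := hq
    have h0 : t - q * β ∈ M.comap (LinearMap.inr R R R) := by
      have := M.sub_mem hv (M.smul_mem q hβ)
      simpa [hq'] using this
    rw [hPc] at h0
    obtain ⟨z, hz⟩ := Ideal.mem_span_singleton'.mp h0
    refine Submodule.mem_span_pair.mpr ⟨q, z, ?_⟩
    simp [hq', hz]
  · rw [Submodule.span_le]
    rintro _ (rfl | rfl)
    exacts [hβ, hcM]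
  · intro x hx
    rw [← hPc]
    have := M.smul_mem x hβ
    simpa [hx] using this

end IsChainComponent

/-- The cardinality of a submodule is the product of the cardinalities of an image and of the
corresponding kernel. -/
theorem card_eq_card_map_mul_card_ker {M M' : Type*} [AddCommGroup M] [Module R M]
    [AddCommGroup M'] [Module R M'] (φ : M →ₗ[R] M') (P : Submodule R M) :
    Nat.card P = Nat.card (P.map φ) * Nat.card (P ⊓ LinearMap.ker φ : Submodule R M) := by
  rw [Submodule.card_eq_card_quotient_mul_card (LinearMap.ker (φ.domRestrict P)),
    mul_comm, Nat.card_congr (φ.domRestrict P).quotKerEquivRange.toEquiv]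
  have h1 : LinearMap.range (φ.domRestrict P) = P.map φ := LinearMap.range_domRestrict P φ
  rw [h1]
  congr 1
  refine Nat.card_congr ⟨fun v => ⟨v.1.1, v.1.2, v.2⟩, fun v => ⟨⟨v.1, v.2.1⟩, v.2.2⟩,
    fun _ => rfl, fun _ => rfl⟩

theorem fst_mem_of_mem_span_triangular {a β c : R} {v : R × R}
    (hv : v ∈ Submodule.span R {(a, β), ((0, c) : R × R)}) : v.1 ∈ Ideal.span {a} := by
  obtain ⟨q, z, rfl⟩ := Submodule.mem_span_pair.mp hv
  exact Ideal.mem_span_singleton'.mpr ⟨q, by simp⟩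

theorem snd_mem_of_mem_span_triangular {a β c : R} (hβ : ∀ x, x * a = 0 → x * β ∈ Ideal.span {c})
    {t : R} (hv : (0, t) ∈ Submodule.span R {(a, β), ((0, c) : R × R)}) : t ∈ Ideal.span {c} := by
  obtain ⟨q, z, hqz⟩ := Submodule.mem_span_pair.mp hv
  have h1 : q * a = 0 := by simpa using congrArg Prod.fst hqz
  have h2 : q * β + z * c = t := by simpa using congrArg Prod.snd hqz
  exact h2 ▸ Ideal.add_mem _ (hβ q h1) (Ideal.mul_mem_left _ _ (Ideal.mem_span_singleton_self _))

/-- The cardinality of a module generated by the rows of an upper triangular matrix. -/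
theorem card_span_triangular {a β c : R} (hβ : ∀ x, x * a = 0 → x * β ∈ Ideal.span {c}) :
    Nat.card (Submodule.span R {(a, β), ((0, c) : R × R)}) =
      Nat.card (Ideal.span {a}) * Nat.card (Ideal.span {c}) := by
  rw [card_eq_card_map_mul_card_ker (LinearMap.fst R R R)]
  congr 1
  · rw [Submodule.map_span, Set.image_pair, Ideal.span, ← Submodule.span_insert_zero (s := {a}),
      Set.pair_comm]
    simp
  · refine Nat.card_congr ⟨fun v => ⟨v.1.2, ?_⟩, fun t => ⟨(0, t.1), ?_, rfl⟩, ?_, ?_⟩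
    · obtain ⟨⟨x, t⟩, hv, hx⟩ := v
      obtain rfl : x = 0 := hx
      exact snd_mem_of_mem_span_triangular hβ hv
    · obtain ⟨z, hz⟩ := Ideal.mem_span_singleton'.mp t.2
      exact Submodule.mem_span_pair.mpr ⟨0, z, by simp [hz]⟩
    · rintro ⟨⟨x, t⟩, -, hx⟩
      obtain rfl : x = 0 := hx
      rfl
    · intro t; rfl

end Chain

/-! ### The group ring as a twisted extension of the cyclic ring -/

section GroupRing

variable {F : Type*} [Field F] {N : ℕ}

theorem cls_surjective : Function.Surjective (cls N : F[X] → CyclicRing F N) :=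
  Ideal.Quotient.mk_surjective

theorem theta_cls (h : F[X]) : theta (cls N h) = aeval ((cls N (X : F[X])) ^ (N - 1)) h := rfl

theorem emb_cls (h : F[X]) : emb (cls N h) =
    aeval (MonoidAlgebra.of F (DihedralGroup N) (DihedralGroup.r 1)) h := rfl

theorem cls_eq_aeval (h : F[X]) : cls N h = aeval (cls N (X : F[X])) h := by
  have : (Ideal.Quotient.mkₐ F (Ideal.span {(X ^ N - 1 : F[X])})) (aeval X h) =
      aeval (cls N (X : F[X])) h := (aeval_algHom_apply _ _ _).symm
  rwa [aeval_X_left_apply] at this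

theorem y_mul_y : (y : GroupRing F N) * y = 1 := by
  rw [y, ← map_mul, DihedralGroup.sr_mul_sr, sub_self, ← DihedralGroup.one_def, map_one]

theorem emb_X_pow (k : ℕ) : emb (cls N (X : F[X]) ^ k) =
    MonoidAlgebra.of F (DihedralGroup N) (DihedralGroup.r k) := by
  rw [map_pow, emb_cls, aeval_X, ← map_pow, DihedralGroup.r_one_pow]

section NeZero

variable [NeZero N]

theorem X_mul_X_pow : cls N (X : F[X]) * cls N X ^ (N - 1) = 1 := by
  rw [← pow_succ', Nat.sub_add_cancel (NeZero.one_le), cls_X_pow]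

theorem theta_theta (a : CyclicRing F N) : theta (theta a) = a := by
  obtain ⟨h, rfl⟩ := cls_surjective a
  rw [theta_cls, ← aeval_algHom_apply, map_pow, theta_cls, aeval_X, cls_eq_aeval h]
  have h1 : (cls N (X : F[X]) * cls N X ^ (N - 1)) ^ (N - 1) = 1 := by
    rw [X_mul_X_pow, one_pow]
  have h2 := X_mul_X_pow (F := F) (N := N)
  rw [mul_pow] at h1
  have h3 : (cls N (X : F[X]) ^ (N - 1)) ^ (N - 1) = cls N X := by
    linear_combination (-(cls N (X : F[X]) ^ (N - 1)) ^ (N - 1)) * h2 + cls N (X : F[X]) * h1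
  rw [h3]

/-- The reciprocal polynomial is, up to a unit, the image of the polynomial under `x ↦ x⁻¹`. -/
theorem exists_theta_cls (h : F[X]) :
    ∃ u : (CyclicRing F N)ˣ, theta (cls N h) = u * cls N h.reverse := by
  let _ : Invertible (cls N (X : F[X]) ^ (N - 1)) :=
    ⟨cls N X, X_mul_X_pow, by rw [mul_comm, X_mul_X_pow]⟩
  have h1 := eval₂_reverse_mul_pow (algebraMap F (CyclicRing F N)) (cls N (X : F[X]) ^ (N - 1)) h
  refine ⟨unitOfInvertible (cls N (X : F[X]) ^ (N - 1)) ^ h.natDegree, ?_⟩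
  rw [theta_cls, aeval_def, ← h1, mul_comm, cls_eq_aeval h.reverse, aeval_def]
  rfl

theorem y_mul_emb (a : CyclicRing F N) : (y : GroupRing F N) * emb a = emb (theta a) * y := by
  obtain ⟨h, rfl⟩ := cls_surjective a
  rw [theta_cls, ← aeval_algHom_apply, emb_cls]
  have hX : y * MonoidAlgebra.of F (DihedralGroup N) (DihedralGroup.r 1) =
      emb (cls N (X : F[X]) ^ (N - 1)) * y := by
    rw [emb_X_pow, y, ← map_mul, ← map_mul, DihedralGroup.sr_mul_r, DihedralGroup.r_mul_sr,
      Nat.cast_sub NeZero.one_le]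
    simp
  induction h using Polynomial.induction_on' with
  | add p q hp hq => rw [map_add, map_add, mul_add, add_mul, hp, hq]
  | monomial k c =>
    have hk : y * MonoidAlgebra.of F (DihedralGroup N) (DihedralGroup.r 1) ^ k =
        emb (cls N (X : F[X]) ^ (N - 1)) ^ k * y := by
      induction k with
      | zero => simp
      | succ k ih => rw [pow_succ, ← mul_assoc, ih, mul_assoc, hX, ← mul_assoc, ← pow_succ]
    rw [aeval_monomial, aeval_monomial, ← mul_assoc, ← Algebra.commutes, mul_assoc, hk, mul_assoc]

/-- The pair `(a, b)` stands for the element `a + b y` of the group ring. -/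
def ofPair : CyclicRing F N × CyclicRing F N →ₗ[F] GroupRing F N :=
  LinearMap.coprod emb.toLinearMap ((LinearMap.mulRight F y).comp emb.toLinearMap)

omit [NeZero N] in
theorem ofPair_apply (v : CyclicRing F N × CyclicRing F N) :
    ofPair v = emb v.1 + emb v.2 * y := rfl

theorem ofPair_surjective :
    Function.Surjective (ofPair : CyclicRing F N × CyclicRing F N → GroupRing F N) := by
  rw [← LinearMap.range_eq_top, eq_top_iff]
  intro z _
  suffices h : Submodule.span F (MonoidAlgebra.of F (DihedralGroup N) '' z.coeff.support) ≤
      LinearMap.range ofPair from h (MonoidAlgebra.mem_span_support_coeff z)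
  rw [Submodule.span_le]
  rintro _ ⟨g, -, rfl⟩
  rcases g with i | i
  · refine ⟨(cls N X ^ i.val, 0), ?_⟩
    simp [ofPair_apply, emb_X_pow]
  · refine ⟨(0, cls N X ^ (-i).val), ?_⟩
    rw [ofPair_apply, emb_X_pow, y, ← map_mul, DihedralGroup.r_mul_sr]
    simp

instance : Module.Finite F (CyclicRing F N) :=
  Module.finite_of_finrank_pos (by
    rw [finrank_quotient_span_eq_natDegree, ← C_1, natDegree_X_pow_sub_C]
    exact Nat.pos_of_neZero N)

/-- `S × S` and the group ring both have dimension `2 N`. -/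
theorem ofPair_injective :
    Function.Injective (ofPair : CyclicRing F N × CyclicRing F N → GroupRing F N) := by
  refine (LinearMap.injective_iff_surjective_of_finrank_eq_finrank ?_).mpr ofPair_surjective
  rw [Module.finrank_prod, finrank_quotient_span_eq_natDegree, ← C_1, natDegree_X_pow_sub_C,
    Module.finrank_eq_nat_card_basis (MonoidAlgebra.basis (DihedralGroup N) F),
    DihedralGroup.nat_card]
  ring

/-- Left multiplication by `y` in terms of pairs: `y (a + b y) = b(x⁻¹) + a(x⁻¹) y`. -/
def twist : CyclicRing F N × CyclicRing F N →+ CyclicRing F N × CyclicRing F N where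
  toFun v := (theta v.2, theta v.1)
  map_zero' := by simp
  map_add' := by simp

omit [NeZero N] in
theorem twist_apply (v : CyclicRing F N × CyclicRing F N) :
    twist v = (theta v.2, theta v.1) := rfl

theorem twist_twist (v : CyclicRing F N × CyclicRing F N) : twist (twist v) = v := by
  simp [twist_apply, theta_theta]

omit [NeZero N] in
theorem twist_smul (a : CyclicRing F N) (v : CyclicRing F N × CyclicRing F N) :
    twist (a • v) = theta a • twist v := by
  simp [twist_apply]

omit [NeZero N] in
theorem ofPair_smul (a : CyclicRing F N) (v : CyclicRing F N × CyclicRing F N) :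
    ofPair (a • v) = emb a * ofPair v := by
  simp [ofPair_apply, mul_add, mul_assoc]

theorem ofPair_twist (v : CyclicRing F N × CyclicRing F N) :
    ofPair (twist v) = y * ofPair v := by
  rw [ofPair_apply, ofPair_apply, twist_apply, mul_add, ← mul_assoc, y_mul_emb, y_mul_emb,
    mul_assoc, y_mul_y, mul_one, add_comm]

/-- The pairs `(a, b)` with `a + b y ∈ C`, as a module over the cyclic ring. -/
def pairs (C : Ideal (GroupRing F N)) :
    Submodule (CyclicRing F N) (CyclicRing F N × CyclicRing F N) where
  carrier := {v | ofPair v ∈ C}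
  zero_mem' := by simp
  add_mem' {v w} hv hw := by
    rw [Set.mem_ofPred_eq, map_add]; exact C.add_mem hv hw
  smul_mem' a v hv := by
    rw [Set.mem_ofPred_eq, ofPair_smul]; exact C.mul_mem_left _ hv

omit [NeZero N] in
theorem mem_pairs {C : Ideal (GroupRing F N)} {v : CyclicRing F N × CyclicRing F N} :
    v ∈ pairs C ↔ ofPair v ∈ C := Iff.rfl

theorem twist_mem_pairs {C : Ideal (GroupRing F N)} {v : CyclicRing F N × CyclicRing F N}
    (hv : v ∈ pairs C) : twist v ∈ pairs C := by
  rw [mem_pairs, ofPair_twist]; exact C.mul_mem_left _ hv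

theorem pairs_injective : Function.Injective (pairs (F := F) (N := N)) := by
  intro C D h
  ext z
  obtain ⟨v, rfl⟩ := ofPair_surjective z
  rw [← mem_pairs, h, mem_pairs]

theorem card_pairs (C : Ideal (GroupRing F N)) : Nat.card (pairs C) = Nat.card C := by
  refine Nat.card_congr (Equiv.ofBijective (fun v => ⟨ofPair v.1, v.2⟩) ⟨?_, ?_⟩)
  · intro v w h
    exact Subtype.ext (ofPair_injective (congrArg Subtype.val h))
  · rintro ⟨z, hz⟩
    obtain ⟨v, rfl⟩ := ofPair_surjective z
    exact ⟨⟨v, hz⟩, rfl⟩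

/-- Left ideals generated by given elements: only their multiples by `y` have to be added. -/
theorem pairs_span (V : Set (CyclicRing F N × CyclicRing F N)) :
    pairs (Ideal.span (ofPair '' V)) = Submodule.span _ (V ∪ twist '' V) := by
  have htw : ∀ v ∈ Submodule.span (CyclicRing F N) (V ∪ twist '' V),
      twist v ∈ Submodule.span (CyclicRing F N) (V ∪ twist '' V) := by
    intro v hv
    induction hv using Submodule.span_induction with
    | mem v hv =>
      rcases hv with hv | ⟨w, hw, rfl⟩
      · exact Submodule.subset_span (Or.inr ⟨v, hv, rfl⟩)
      · rw [twist_twist]; exact Submodule.subset_span (Or.inl hw)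
    | zero => rw [map_zero]; exact Submodule.zero_mem _
    | add v w _ _ hv hw => rw [map_add]; exact Submodule.add_mem _ hv hw
    | smul a v _ hv => rw [twist_smul]; exact Submodule.smul_mem _ _ hv
  apply le_antisymm
  · intro v hv
    obtain ⟨w, hw, hwv⟩ : ∃ w ∈ Submodule.span (CyclicRing F N) (V ∪ twist '' V),
        ofPair w = ofPair v := by
      rw [mem_pairs] at hv
      generalize ofPair v = z at hv
      induction hv using Submodule.span_induction with
      | mem z hz =>
        obtain ⟨w, hw, rfl⟩ := hz
        exact ⟨w, Submodule.subset_span (Or.inl hw), rfl⟩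
      | zero => exact ⟨0, Submodule.zero_mem _, map_zero _⟩
      | add z z' _ _ hz hz' =>
        obtain ⟨w, hw, rfl⟩ := hz
        obtain ⟨w', hw', rfl⟩ := hz'
        exact ⟨w + w', Submodule.add_mem _ hw hw', map_add _ _ _⟩
      | smul g z _ hz =>
        obtain ⟨w, hw, rfl⟩ := hz
        obtain ⟨⟨a, b⟩, rfl⟩ := ofPair_surjective g
        refine ⟨a • w + b • twist w,
          Submodule.add_mem _ (Submodule.smul_mem _ _ hw) (Submodule.smul_mem _ _ (htw w hw)), ?_⟩
        rw [map_add, ofPair_smul, ofPair_smul, ofPair_twist, smul_eq_mul, ofPair_apply (a, b),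
          add_mul, mul_assoc]
    exact ofPair_injective hwv ▸ hw
  · rw [Submodule.span_le, Set.union_subset_iff]
    have h1 : V ⊆ pairs (Ideal.span (ofPair '' V)) := fun v hv =>
      Ideal.subset_span (Set.mem_image_of_mem _ hv)
    refine ⟨h1, ?_⟩
    rintro _ ⟨v, hv, rfl⟩
    exact twist_mem_pairs (h1 hv)

end NeZero

end GroupRing

section Components

variable {F : Type*} [Field F] {N : ℕ} [NeZero N]

/-! ### Left ideals in a self-reciprocal component -/

section SelfReciprocal

variable {A : Ideal (CyclicRing F N)} {e γ : CyclicRing F N} {s : ℕ} {u : (CyclicRing F N)ˣ}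

omit [NeZero N] in
theorem theta_cpow {e' γ' : CyclicRing F N} (he : theta e = e') (hu : theta γ = u * γ') (k : ℕ) :
    theta (cpow e γ k) = u ^ k * cpow e' γ' k := by
  rw [cpow, cpow, map_mul, map_pow, he, hu, mul_pow]; ring

/-- The forms A2 with `a = b` are those of the list A1. -/
theorem idealA2_self (he : theta e = e) (hu : theta γ = u * γ) (b : ℕ) (ρ : CyclicRing F N) :
    idealA2 e γ b b ρ = idealA1 e γ b := by
  apply le_antisymm
  · rw [idealA2, Ideal.span_le, Set.insert_subset_iff, Set.singleton_subset_iff]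
    refine ⟨?_, Ideal.mem_span_singleton_self _⟩
    have h1 : emb (cpow e γ b) * (y + emb ρ) =
        (y * emb ((u : CyclicRing F N) ^ b) + emb ρ) * emb (cpow e γ b) := by
      rw [mul_add, add_mul, mul_assoc, ← map_mul, ← map_mul, ← map_mul, ← theta_cpow he hu,
        y_mul_emb, theta_theta, mul_comm ρ]
    rw [h1]
    exact Ideal.mul_mem_left _ _ (Ideal.mem_span_singleton_self _)
  · rw [idealA1, Ideal.span_singleton_le_iff_mem]
    exact Ideal.subset_span (Or.inr rfl)

variable (h : IsChainComponent A e γ s) (he : theta e = e) (hu : theta γ = u * γ)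
include h he hu

/-- The triangular form of an ideal of the list A2: up to units, `twist` sends the generators
`(γ ^ a ρ, γ ^ a)` and `(γ ^ b, 0)` to the two rows, and these generate all four elements. -/
theorem pairs_idealA2 {a b : ℕ} {ρ : CyclicRing F N} (hab : a ≤ b)
    (hρ : ρ * theta ρ - e ∈ Ideal.span {cpow e γ (b - a)}) :
    pairs (idealA2 e γ a b ρ) = Submodule.span (CyclicRing F N)
      {(cpow e γ a, cpow e γ a * theta ρ), (0, cpow e γ b)} := by
  have h1 : idealA2 e γ a b ρ =
      Ideal.span (ofPair '' {(cpow e γ a * ρ, cpow e γ a), (cpow e γ b, 0)}) := by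
    rw [Set.image_pair, idealA2]
    simp [ofPair_apply, mul_add, add_comm]
  obtain ⟨c, hc⟩ := Ideal.mem_span_singleton'.mp hρ
  have hγ : cpow e γ (b - a) * cpow e γ a = cpow e γ b := by
    rw [h.cpow_mul_cpow, Nat.sub_add_cancel hab]
  have hγe := h.cpow_mul_identity a
  have hua : ((u⁻¹ : (CyclicRing F N)ˣ) ^ a : CyclicRing F N) * (u : CyclicRing F N) ^ a = 1 := by
    rw [← mul_pow, Units.inv_mul, one_pow]
  have hub : ((u⁻¹ : (CyclicRing F N)ˣ) ^ b : CyclicRing F N) * (u : CyclicRing F N) ^ b = 1 := by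
    rw [← mul_pow, Units.inv_mul, one_pow]
  rw [h1, pairs_span, Set.image_pair]
  simp only [twist_apply, map_mul, theta_cpow he hu, map_zero]
  apply le_antisymm
  · rw [Submodule.span_le]
    rintro _ ((rfl | rfl) | (rfl | rfl)) <;> refine Submodule.mem_span_pair.mpr ?_
    · refine ⟨ρ, -c, Prod.ext ?_ ?_⟩
      · simp [mul_comm]
      · simp only [Prod.smul_mk, Prod.mk_add_mk, smul_eq_mul]
        linear_combination (-cpow e γ a) * hc + c * hγ + hγe
    · refine ⟨cpow e γ (b - a), -theta ρ, Prod.ext ?_ ?_⟩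
      · simp [hγ]
      · simp only [Prod.smul_mk, Prod.mk_add_mk, smul_eq_mul]
        linear_combination theta ρ * hγ
    · exact ⟨u ^ a, 0, by simp [mul_assoc]⟩
    · exact ⟨0, u ^ b, by simp⟩
  · rw [Submodule.span_le]
    rintro _ (rfl | rfl)
    · have h2 := Submodule.smul_mem _ ((u⁻¹ : (CyclicRing F N)ˣ) ^ a : CyclicRing F N)
        (Submodule.subset_span (R := CyclicRing F N)
          (show ((u : CyclicRing F N) ^ a * cpow e γ a, u ^ a * cpow e γ a * theta ρ) ∈
            ({(cpow e γ a * ρ, cpow e γ a), (cpow e γ b, 0)} ∪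
            {((u : CyclicRing F N) ^ a * cpow e γ a, u ^ a * cpow e γ a * theta ρ),
              (0, u ^ b * cpow e γ b)} : Set (CyclicRing F N × CyclicRing F N)) by simp))
      rwa [Prod.smul_mk, smul_eq_mul, smul_eq_mul, ← mul_assoc, ← mul_assoc, ← mul_assoc, hua,
        one_mul] at h2
    · have h2 := Submodule.smul_mem _ ((u⁻¹ : (CyclicRing F N)ˣ) ^ b : CyclicRing F N)
        (Submodule.subset_span (R := CyclicRing F N)
          (show ((0 : CyclicRing F N), u ^ b * cpow e γ b) ∈
            ({(cpow e γ a * ρ, cpow e γ a), (cpow e γ b, 0)} ∪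
            {((u : CyclicRing F N) ^ a * cpow e γ a, u ^ a * cpow e γ a * theta ρ),
              (0, u ^ b * cpow e γ b)} : Set (CyclicRing F N × CyclicRing F N)) by simp))
      rwa [Prod.smul_mk, smul_eq_mul, smul_eq_mul, ← mul_assoc, hub, one_mul, mul_zero] at h2

theorem card_idealA2 {a b : ℕ} {ρ : CyclicRing F N} (hab : a ≤ b)
    (hρ : ρ * theta ρ - e ∈ Ideal.span {cpow e γ (b - a)}) :
    Nat.card (idealA2 e γ a b ρ) =
      Nat.card (Ideal.span {cpow e γ a}) * Nat.card (Ideal.span {cpow e γ b}) := by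
  rw [← card_pairs, pairs_idealA2 h he hu hab hρ, card_span_triangular]
  intro x hx
  rw [← mul_assoc, hx, zero_mul]
  exact Ideal.zero_mem _

/-- Left ideals of a self-reciprocal component: stability of the triangular form under `twist` yields
the conditions on its entries. -/
theorem exists_eq_idealA2 {C : Ideal (GroupRing F N)} (hC : ∀ v ∈ pairs C, e • v = v) :
    ∃ a b ρ, a ≤ b ∧ b ≤ s ∧ ρ ∈ A ∧ ρ * theta ρ - e ∈ Ideal.span {cpow e γ (b - a)} ∧
      C = idealA2 e γ a b ρ := by
  obtain ⟨a, ha, b, hb, β, hβA, hM, hβ⟩ := h.exists_submodule_eq hC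
  have hv : (cpow e γ a, β) ∈ pairs C := hM ▸ Submodule.subset_span (by simp)
  have hw : (0, cpow e γ b) ∈ pairs C := hM ▸ Submodule.subset_span (by simp)
  have hfst : ∀ v ∈ pairs C, v.1 ∈ Ideal.span {cpow e γ a} := fun v hv =>
    fst_mem_of_mem_span_triangular (hM ▸ hv)
  have hua : ((u⁻¹ : (CyclicRing F N)ˣ) ^ a : CyclicRing F N) * (u : CyclicRing F N) ^ a = 1 := by
    rw [← mul_pow, Units.inv_mul, one_pow]
  have hab : a ≤ b := by
    apply h.le_of_cpow_mem ha
    have h1 := hfst _ (twist_mem_pairs hw)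
    simp only [twist_apply, theta_cpow he hu] at h1
    rwa [← Units.val_pow_eq_pow_val, Ideal.unit_mul_mem_iff_mem _ (Units.isUnit _)] at h1
  obtain ⟨c, hc⟩ := Ideal.mem_span_singleton'.mp (hfst _ (twist_mem_pairs hv))
  have hc : c * cpow e γ a = theta β := hc
  have hβ' : β = theta c * (u ^ a * cpow e γ a) := by
    rw [← theta_cpow he hu, ← map_mul, hc, theta_theta]
  obtain ⟨ρ, hρA, hρ⟩ : ∃ ρ ∈ A, β = cpow e γ a * theta ρ := by
    refine ⟨e * (c * theta ((u : CyclicRing F N) ^ a)), A.mul_mem_right _ h.identity_mem, ?_⟩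
    rw [map_mul, map_mul, theta_theta, he, ← mul_assoc, h.cpow_mul_identity, hβ']
    ring
  have hnorm : ρ * theta ρ - e ∈ Ideal.span {cpow e γ (b - a)} := by
    apply h.mem_span_of_cpow_mul_mem hb
      (A.sub_mem (A.mul_mem_right _ hρA) h.identity_mem)
    apply snd_mem_of_mem_span_triangular hβ
    rw [← hM]
    have h1 := (pairs C).sub_mem ((pairs C).smul_mem ρ hv) ((pairs C).smul_mem
      ((u⁻¹ : (CyclicRing F N)ˣ) ^ a : CyclicRing F N) (twist_mem_pairs hv))
    convert h1 using 1
    simp only [twist_apply, theta_cpow he hu, hρ, map_mul, theta_theta, Prod.smul_mk, smul_eq_mul,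
      Prod.mk_sub_mk]
    refine Prod.ext ?_ ?_
    · simp only
      linear_combination cpow e γ a * ρ * hua
    · simp only
      linear_combination (-cpow e γ a) * hua - h.cpow_mul_identity a + 2 * cpow e γ a * hua
  refine ⟨a, b, ρ, hab, hb, hρA, hnorm, pairs_injective ?_⟩
  rw [pairs_idealA2 h he hu hab hnorm, hM, hρ]

end SelfReciprocal

/-! ### Left ideals in a component of two reciprocal factors -/

section ReciprocalPair

variable {A : Ideal (CyclicRing F N)} {e₁ e₂ γ₁ γ₂ : CyclicRing F N} {s : ℕ}
  {u : (CyclicRing F N)ˣ}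

omit [NeZero N] in
theorem smul_twist (h₂ : theta e₂ = e₁) (v : CyclicRing F N × CyclicRing F N) :
    e₁ • twist v = twist (e₂ • v) := by
  rw [twist_smul, h₂]

/-- A left ideal of the component is determined by its part in the first of the two chain rings. -/
theorem le_of_map_smul_le (h₂ : theta e₂ = e₁)
    {C D : Ideal (GroupRing F N)} (hC : ∀ v ∈ pairs C, (e₁ + e₂) • v = v)
    (hle : (pairs C).map (LinearMap.lsmul _ _ e₁) ≤ pairs D) : pairs C ≤ pairs D := by
  intro v hv
  rw [← hC v hv, add_smul]
  refine Submodule.add_mem _ (hle (Submodule.mem_map_of_mem hv)) ?_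
  rw [← twist_twist (e₂ • v), ← smul_twist h₂]
  exact twist_mem_pairs (hle (Submodule.mem_map_of_mem (twist_mem_pairs hv)))

omit [NeZero N] in
theorem map_smul_le (C : Ideal (GroupRing F N)) :
    (pairs C).map (LinearMap.lsmul _ _ e₁) ≤ pairs C := by
  rintro _ ⟨v, hv, rfl⟩
  exact Submodule.smul_mem _ _ hv

/-- The parts of a left ideal over the two chain rings are exchanged by `twist`. -/
theorem card_eq_card_map_sq (h₁ : theta e₁ = e₂) (h₂ : theta e₂ = e₁) (h12 : e₁ * e₂ = 0)
    {C : Ideal (GroupRing F N)} (hC : ∀ v ∈ pairs C, (e₁ + e₂) • v = v) :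
    Nat.card C = Nat.card ((pairs C).map (LinearMap.lsmul _ _ e₁)) ^ 2 := by
  rw [← card_pairs, card_eq_card_map_mul_card_ker (LinearMap.lsmul _ _ e₁), sq]
  congr 1
  refine Nat.card_congr ⟨fun v => ⟨twist v.1, twist v.1, twist_mem_pairs v.2.1, ?_⟩,
    fun v => ⟨twist v.1, twist_mem_pairs (map_smul_le C v.2), ?_⟩,
    fun v => Subtype.ext (twist_twist _), fun v => Subtype.ext (twist_twist _)⟩
  · have h0 : e₁ • v.1 = 0 := v.2.2
    have h1 := hC v.1 v.2.1
    rw [add_smul, h0, zero_add] at h1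
    rw [LinearMap.lsmul_apply, smul_twist h₂, h1]
  · obtain ⟨_, w, hw, rfl⟩ := v
    change e₁ • twist (e₁ • w) = 0
    rw [twist_smul, h₁, smul_smul, h12]
    exact zero_smul (CyclicRing F N) (twist w)

variable (h : IsChainComponent A e₁ γ₁ s) (h₁ : theta e₁ = e₂) (h₂ : theta e₂ = e₁)
  (h12 : e₁ * e₂ = 0) (hu : theta γ₂ = u * γ₁)
include h h₁ h₂ h12 hu

/-- The left ideal generated by `γ₁ ^ a + γ₂ ^ c + β y`, with `β` in the first chain ring, belongs to
the component of `e₁ + e₂`. Its part over the first chain ring contains `(0, γ₁ ^ c)` because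
`twist` moves `γ₂ ^ c` to a multiple of `γ₁ ^ c` by a unit. -/
theorem smul_eq_and_map_idealB {β : CyclicRing F N} (hβ : β ∈ A) (a c : ℕ) {C : Ideal (GroupRing F N)}
    (hC : C = Ideal.span {emb (cpow e₁ γ₁ a + cpow e₂ γ₂ c) + emb β * y}) :
    (∀ v ∈ pairs C, (e₁ + e₂) • v = v) ∧
    (pairs C).map (LinearMap.lsmul _ _ e₁) =
      Submodule.span _ {(cpow e₁ γ₁ a, β), (0, cpow e₁ γ₁ c)} := by
  have h1 : C = Ideal.span (ofPair '' {(cpow e₁ γ₁ a + cpow e₂ γ₂ c, β)}) := by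
    rw [Set.image_singleton, hC, ofPair_apply]
  have hpairs : pairs C = Submodule.span _ {(cpow e₁ γ₁ a + cpow e₂ γ₂ c, β),
      twist (cpow e₁ γ₁ a + cpow e₂ γ₂ c, β)} := by
    rw [h1, pairs_span, Set.image_singleton, Set.singleton_union]
  have hβ1 : e₁ * β = β := h.identity_mul β hβ
  have hβ2 : e₂ * β = 0 := by rw [← hβ1, ← mul_assoc, mul_comm e₂, h12, zero_mul]
  have h22 : e₂ * e₂ = e₂ := by rw [← h₁, ← map_mul, h.identity_mul_self]
  have ha1 := h.identity_mul_cpow a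
  have ha2 : e₂ * cpow e₁ γ₁ a = 0 := by rw [cpow, ← mul_assoc, mul_comm e₂, h12, zero_mul]
  have hc1 : e₁ * cpow e₂ γ₂ c = 0 := by rw [cpow, ← mul_assoc, h12, zero_mul]
  have hc2 : e₂ * cpow e₂ γ₂ c = cpow e₂ γ₂ c := by rw [cpow, ← mul_assoc, h22]
  have hv1 : e₁ • (cpow e₁ γ₁ a + cpow e₂ γ₂ c, β) = (cpow e₁ γ₁ a, β) := by
    simp [mul_add, ha1, hc1, hβ1]
  have hv2 : e₂ • (cpow e₁ γ₁ a + cpow e₂ γ₂ c, β) = (cpow e₂ γ₂ c, 0) := by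
    simp [mul_add, ha2, hc2, hβ2]
  have hfix : (e₁ + e₂) • (cpow e₁ γ₁ a + cpow e₂ γ₂ c, β) = (cpow e₁ γ₁ a + cpow e₂ γ₂ c, β) := by
    rw [add_smul, hv1, hv2]; simp
  constructor
  · rw [hpairs]
    intro v hv
    obtain ⟨x, z, rfl⟩ := Submodule.mem_span_pair.mp hv
    have hfix' : (e₁ + e₂) • twist (cpow e₁ γ₁ a + cpow e₂ γ₂ c, β) =
        twist (cpow e₁ γ₁ a + cpow e₂ γ₂ c, β) := by
      conv_rhs => rw [← hfix]
      rw [twist_smul, map_add, h₁, h₂, add_comm]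
    rw [smul_add, smul_comm _ x, smul_comm _ z, hfix, hfix']
  · rw [hpairs, Submodule.map_span, Set.image_pair, LinearMap.lsmul_apply, LinearMap.lsmul_apply,
      hv1, smul_twist h₂, hv2, twist_apply, map_zero, theta_cpow h₂ hu]
    have hw : ((0, u ^ c * cpow e₁ γ₁ c) : CyclicRing F N × CyclicRing F N) =
        (u ^ c) • (0, cpow e₁ γ₁ c) := by
      simp [Units.smul_def]
    rw [hw, Submodule.span_insert, Submodule.span_insert]
    congr 1
    exact Submodule.span_singleton_group_smul_eq _ _ _

/-- The condition `hac` says that no combination of `(γ₁ ^ a, β)` and `(0, γ₁ ^ c)` with vanishing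
first entry is new. -/
theorem card_idealB {β : CyclicRing F N} (hβ : β ∈ A) (a c : ℕ) {C : Ideal (GroupRing F N)}
    (hC : C = Ideal.span {emb (cpow e₁ γ₁ a + cpow e₂ γ₂ c) + emb β * y})
    (hac : ∀ x, x * cpow e₁ γ₁ a = 0 → x * β ∈ Ideal.span {cpow e₁ γ₁ c}) :
    Nat.card C =
      (Nat.card (Ideal.span {cpow e₁ γ₁ a}) * Nat.card (Ideal.span {cpow e₁ γ₁ c})) ^ 2 := by
  obtain ⟨hfix, hmap⟩ := smul_eq_and_map_idealB h h₁ h₂ h12 hu hβ a c hC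
  rw [card_eq_card_map_sq h₁ h₂ h12 hfix, hmap, card_span_triangular hac]

theorem card_idealB1 (a c : ℕ) : Nat.card (idealB1 e₁ γ₁ e₂ γ₂ a c) =
    (Nat.card (Ideal.span {cpow e₁ γ₁ a}) * Nat.card (Ideal.span {cpow e₁ γ₁ c})) ^ 2 :=
  card_idealB h h₁ h₂ h12 hu A.zero_mem a c (by simp [idealB1]) (by simp)

theorem card_idealB2 {a b c : ℕ} {α : CyclicRing F N} (hp : ParamB2 A e₁ γ₁ s a b c α) :
    Nat.card (idealB2 e₁ γ₁ e₂ γ₂ a b c α) =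
    (Nat.card (Ideal.span {cpow e₁ γ₁ a}) * Nat.card (Ideal.span {cpow e₁ γ₁ c})) ^ 2 := by
  refine card_idealB h h₁ h₂ h12 hu (A.mul_mem_left _ hp.mem) a c rfl fun x hx => ?_
  have hmem : e₁ * x ∈ Ideal.span {cpow e₁ γ₁ (s - a)} := by
    apply h.mem_span_of_cpow_mul_mem le_rfl (A.mul_mem_right _ h.identity_mem)
    rw [← mul_assoc, h.cpow_mul_identity, mul_comm, hx]
    exact Ideal.zero_mem _
  obtain ⟨t, ht⟩ := Ideal.mem_span_singleton'.mp hmem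
  have h1 : x * (cpow e₁ γ₁ b * α) = t * α * cpow e₁ γ₁ (s - a + b) := by
    rw [← h.cpow_mul_cpow]
    linear_combination (-cpow e₁ γ₁ b * α) * ht - x * α * h.identity_mul_cpow b
  have := hp.le_b
  rw [h1]
  exact Ideal.mul_mem_left _ _ (span_cpow_anti _ _ (by omega : c ≤ s - a + b)
    (Ideal.mem_span_singleton_self _))

/-- Left ideals of the component of two reciprocal factors: the two cases are those in which the entry
`γ₁ ^ b α` of the triangular form can, or cannot, be reduced to `0` by the row `(0, γ₁ ^ c)`. -/
theorem exists_eq_idealB {C : Ideal (GroupRing F N)} (hC : ∀ v ∈ pairs C, (e₁ + e₂) • v = v) :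
    (∃ a c, a ≤ s ∧ c ≤ s ∧ C = idealB1 e₁ γ₁ e₂ γ₂ a c) ∨
    (∃ a b c α, ParamB2 A e₁ γ₁ s a b c α ∧ C = idealB2 e₁ γ₁ e₂ γ₂ a b c α) := by
  have heq : ∀ {D : Ideal (GroupRing F N)}, (∀ v ∈ pairs D, (e₁ + e₂) • v = v) →
      (pairs C).map (LinearMap.lsmul _ _ e₁) = (pairs D).map (LinearMap.lsmul _ _ e₁) →
      C = D := fun hD hmap => pairs_injective <| le_antisymm
    (le_of_map_smul_le h₂ hC (hmap ▸ map_smul_le _))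
    (le_of_map_smul_le h₂ hD (hmap ▸ map_smul_le _))
  obtain ⟨a, ha, c, hc, β, hβA, hM, hβ⟩ := h.exists_submodule_eq
    (M := (pairs C).map (LinearMap.lsmul _ _ e₁)) (by
      rintro _ ⟨v, -, rfl⟩
      rw [LinearMap.lsmul_apply, smul_smul, h.identity_mul_self])
  obtain ⟨b, -, α, hα, v, hv, hαv, rfl⟩ := h.exists_unit hβA
  -- a power of `γ₁` times `α` lies in an ideal only if that power itself does
  have hunit : ∀ k, cpow e₁ γ₁ k * α ∈ Ideal.span {cpow e₁ γ₁ c} → c ≤ k := by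
    intro k hk
    apply h.le_of_cpow_mem hc
    have := Ideal.mul_mem_right v _ hk
    rwa [mul_assoc, hαv, h.cpow_mul_identity] at this
  by_cases hcb : c ≤ b
  · left
    obtain ⟨hfix, hmap⟩ := smul_eq_and_map_idealB h h₁ h₂ h12 hu A.zero_mem a c
      (C := idealB1 e₁ γ₁ e₂ γ₂ a c) (by simp [idealB1])
    refine ⟨a, c, ha, hc, heq hfix ?_⟩
    rw [hmap, hM]
    obtain ⟨z, hz⟩ := Ideal.mem_span_singleton'.mp (Ideal.mul_mem_right α _
      (span_cpow_anti e₁ γ₁ hcb (Ideal.mem_span_singleton_self _)))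
    apply le_antisymm <;> rw [Submodule.span_le] <;> rintro _ (rfl | rfl) <;>
      refine Submodule.mem_span_pair.mpr ?_
    · exact ⟨1, z, by simp [hz]⟩
    · exact ⟨0, 1, by simp⟩
    · exact ⟨1, -z, by simp [hz]⟩
    · exact ⟨0, 1, by simp⟩
  · right
    push Not at hcb
    obtain ⟨hfix, hmap⟩ := smul_eq_and_map_idealB h h₁ h₂ h12 hu hβA a c
      (C := idealB2 e₁ γ₁ e₂ γ₂ a b c α) rfl
    refine ⟨a, b, c, α, ⟨?_, by omega, hc, ?_, hcb, hα, v, hv, ?_⟩, heq hfix (hM.trans hmap.symm)⟩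
    · refine lt_of_le_of_ne ha fun has => ?_
      have := hunit b (by simpa using hβ 1 (by rw [has, h.cpow_eq_zero, mul_zero]))
      omega
    · have := hβ (cpow e₁ γ₁ (s - a)) (by
        rw [h.cpow_mul_cpow, Nat.sub_add_cancel ha, h.cpow_eq_zero])
      rw [← mul_assoc, h.cpow_mul_cpow] at this
      have := hunit _ this
      omega
    · rw [hαv, sub_self]; exact Ideal.zero_mem _

end ReciprocalPair

/-! ### Decomposition along central idempotents -/

section Decomposition

/-- A left ideal is the direct sum of its parts cut out by idempotents that are invariant under
`x ↦ x⁻¹`, as these are central in the group ring. -/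
theorem exists_direct_sum {ι : Type*} [Fintype ι] {ε : ι → CyclicRing F N}
    (hε : CompleteOrthogonalIdempotents ε) (hθ : ∀ k, theta (ε k) = ε k)
    (C : Ideal (GroupRing F N)) :
    ∃ D : ι → Ideal (GroupRing F N), iSupIndep D ∧ (⨆ k, D k) = C ∧
      ∀ k, ∀ v ∈ pairs (D k), ε k • v = v := by
  classical
  have hcomm : ∀ k z, emb (ε k) * z = z * emb (ε k) := by
    intro k z
    obtain ⟨v, rfl⟩ := ofPair_surjective z
    have h1 : emb v.2 * y * emb (ε k) = emb (ε k) * (emb v.2 * y) := by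
      rw [mul_assoc, y_mul_emb, hθ, ← mul_assoc, ← mul_assoc, ← map_mul, ← map_mul, mul_comm]
    rw [ofPair_apply, mul_add, add_mul, h1, ← map_mul, ← map_mul, mul_comm]
  let D : ι → Ideal (GroupRing F N) := fun k =>
    { carrier := {z | z ∈ C ∧ emb (ε k) * z = z}
      zero_mem' := ⟨C.zero_mem, mul_zero _⟩
      add_mem' := fun {z w} hz hw => ⟨C.add_mem hz.1 hw.1, by rw [mul_add, hz.2, hw.2]⟩
      smul_mem' := fun g z hz => ⟨C.mul_mem_left g hz.1, by
        rw [smul_eq_mul, ← mul_assoc, hcomm, mul_assoc, hz.2]⟩ }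
  refine ⟨D, ?_, le_antisymm (iSup_le fun k z hz => hz.1) ?_, ?_⟩
  · intro k
    rw [Submodule.disjoint_def]
    intro z hz hz'
    let K : Ideal (GroupRing F N) :=
      { carrier := {z | emb (ε k) * z = 0}
        zero_mem' := mul_zero _
        add_mem' := fun {z w} hz hw => by
          rw [Set.mem_ofPred_eq] at hz hw ⊢
          rw [mul_add, hz, hw, add_zero]
        smul_mem' := fun g z hz => by
          rw [Set.mem_ofPred_eq] at hz ⊢
          rw [smul_eq_mul, ← mul_assoc, hcomm, mul_assoc, hz, mul_zero] }
    have hle : (⨆ j, ⨆ (_ : j ≠ k), D j) ≤ K := by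
      refine iSup₂_le fun j hj w hw => ?_
      change emb (ε k) * w = 0
      rw [← hw.2, ← mul_assoc, ← map_mul, hε.ortho hj.symm, map_zero, zero_mul]
    have h0 : emb (ε k) * z = 0 := hle hz'
    rw [← hz.2, h0]
  · intro z hz
    have h1 : z = ∑ k, emb (ε k) * z := by
      rw [← Finset.sum_mul, ← map_sum, hε.complete, map_one, one_mul]
    rw [h1]
    refine Submodule.sum_mem _ fun k _ => Submodule.mem_iSup_of_mem k ⟨C.mul_mem_left _ hz, ?_⟩
    rw [← mul_assoc, ← map_mul, (hε.idem k).eq]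
  · intro k v hv
    apply ofPair_injective
    rw [ofPair_smul]
    exact hv.2

end Decomposition

end Components

/-! ### The primary components of the cyclic ring -/

section Primary

variable {F : Type*} [Field F] {N : ℕ} {φ ψ : F[X]} {s : ℕ} {e e' : CyclicRing F N}

theorem cls_mul (p q : F[X]) : cls N (p * q) = cls N p * cls N q := map_mul _ p q

theorem cls_add (p q : F[X]) : cls N (p + q) = cls N p + cls N q := map_add _ p q

theorem cls_pow (p : F[X]) (k : ℕ) : cls N (p ^ k) = cls N p ^ k := map_pow _ p k

theorem cls_one : cls N (1 : F[X]) = 1 := map_one _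

theorem cls_eq_zero_iff {p : F[X]} : cls N p = 0 ↔ X ^ N - 1 ∣ p :=
  Ideal.Quotient.eq_zero_iff_mem.trans Ideal.mem_span_singleton

/-- `e` is the idempotent of the component of `F[x] / (x ^ N - 1)` that belongs to the factor
`φ ^ s`: it is `1` modulo `φ ^ s`, and `0` modulo the complementary factor, which is expressed by
`e φ ^ s = 0` so that the cofactor need not be named. -/
structure IsPrimaryIdempotent (φ : F[X]) (s : ℕ) (e : CyclicRing F N) : Prop where
  mul_eq_zero : e * cls N φ ^ s = 0
  dvd : cls N φ ^ s ∣ 1 - e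

theorem exists_isPrimaryIdempotent {h : F[X]} (hh : φ ^ s * h = X ^ N - 1)
    (hco : IsCoprime (φ ^ s) h) : ∃ e : CyclicRing F N, IsPrimaryIdempotent φ s e := by
  obtain ⟨a, b, hab⟩ := hco
  refine ⟨cls N (b * h), ?_, cls N a, ?_⟩
  · rw [← cls_pow, ← cls_mul, cls_eq_zero_iff]
    exact ⟨b, by rw [← hh]; ring⟩
  · have h1 : cls N (a * φ ^ s) + cls N (b * h) = 1 := by rw [← cls_add, hab, cls_one]
    rw [← h1, add_sub_cancel_right, cls_mul, cls_pow, mul_comm]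

namespace IsPrimaryIdempotent

theorem unique (h : IsPrimaryIdempotent φ s e) (h' : IsPrimaryIdempotent φ s e') : e = e' := by
  obtain ⟨c, hc⟩ := h.dvd
  obtain ⟨c', hc'⟩ := h'.dvd
  linear_combination e * hc' - e' * hc + c' * h.mul_eq_zero - c * h'.mul_eq_zero

theorem mul_self (h : IsPrimaryIdempotent φ s e) : e * e = e := by
  obtain ⟨c, hc⟩ := h.dvd
  linear_combination (-e) * hc - c * h.mul_eq_zero

theorem mul_eq_zero_of_isCoprime (h : IsPrimaryIdempotent φ s e)
    (h' : IsPrimaryIdempotent ψ s e') (hco : IsCoprime φ ψ) : e * e' = 0 := by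
  obtain ⟨a, b, hab⟩ := hco.pow (m := s) (n := s)
  have h1 : cls N a * cls N φ ^ s + cls N b * cls N ψ ^ s = 1 := by
    rw [← cls_pow, ← cls_pow, ← cls_mul, ← cls_mul, ← cls_add, hab, cls_one]
  linear_combination (-(e * e')) * h1 + e' * cls N a * h.mul_eq_zero +
    e * cls N b * h'.mul_eq_zero

theorem of_associated (h : IsPrimaryIdempotent φ s e) (hφ : Associated φ ψ) :
    IsPrimaryIdempotent ψ s e := by
  obtain ⟨v, rfl⟩ := hφ
  constructor
  · rw [cls_mul, mul_pow, ← mul_assoc, h.mul_eq_zero, zero_mul]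
  · have h1 : cls N φ = cls N (φ * (v : F[X])) * cls N ((v⁻¹ : F[X]ˣ) : F[X]) := by
      rw [← cls_mul, mul_assoc, Units.mul_inv, mul_one]
    refine dvd_trans ?_ h.dvd
    rw [h1, mul_pow]
    exact dvd_mul_right _ _

theorem theta_eq [NeZero N] (h : IsPrimaryIdempotent φ s e)
    (h' : IsPrimaryIdempotent φ.reverse s e') : theta e = e' := by
  obtain ⟨u, hu⟩ := exists_theta_cls (N := N) φ
  refine IsPrimaryIdempotent.unique ⟨?_, ?_⟩ h'
  · have h1 := congrArg theta h.mul_eq_zero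
    rwa [map_mul, map_pow, hu, map_zero, mul_pow, mul_left_comm, ← Units.val_pow_eq_pow_val,
      Units.mul_right_eq_zero] at h1
  · have h1 := map_dvd theta h.dvd
    rw [map_sub, map_one, map_pow, hu, mul_pow] at h1
    exact (dvd_mul_left _ _).trans h1

variable (h : IsPrimaryIdempotent φ s e)
include h

/-- The kernel of `p ↦ e p` is generated by `φ ^ s`. -/
theorem mul_cls_eq_zero_iff (hdvd : φ ^ s ∣ X ^ N - 1) {p : F[X]} :
    e * cls N p = 0 ↔ φ ^ s ∣ p := by
  constructor
  · intro hp
    obtain ⟨c, hc⟩ := h.dvd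
    obtain ⟨c, rfl⟩ := cls_surjective c
    have h1 : cls N (p - φ ^ s * c * p) = 0 := by
      rw [cls, map_sub]
      change cls N p - cls N (φ ^ s * c * p) = 0
      rw [cls_mul, cls_mul, cls_pow]
      linear_combination cls N p * hc + hp
    have h2 := hdvd.trans (cls_eq_zero_iff.mp h1)
    rwa [dvd_sub_left ((dvd_mul_right _ _).trans (dvd_mul_right _ _))] at h2
  · rintro ⟨c, rfl⟩
    rw [cls_mul, cls_pow, ← mul_assoc, h.mul_eq_zero, zero_mul]

theorem component_eq_span (hdvd : φ ^ s ∣ X ^ N - 1) (hφ : φ ≠ 0) :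
    component N (φ ^ s) = Ideal.span {e} := by
  have hh : φ ^ s * ((X ^ N - 1) / φ ^ s) = X ^ N - 1 :=
    EuclideanDomain.mul_div_cancel' (pow_ne_zero s hφ) hdvd
  obtain ⟨c, hc⟩ := h.dvd
  rw [component]
  generalize (X ^ N - 1) / φ ^ s = q at hh
  have hq : cls N φ ^ s * cls N q = 0 := by
    rw [← cls_pow, ← cls_mul, hh, cls_eq_zero_iff]
  apply le_antisymm <;> rw [Ideal.span_singleton_le_span_singleton]
  · exact ⟨cls N q, by linear_combination cls N q * hc + c * hq⟩
  · obtain ⟨q', rfl⟩ := cls_surjective e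
    have h1 := h.mul_eq_zero
    rw [← cls_pow, ← cls_mul, cls_eq_zero_iff, ← hh, mul_comm q',
      mul_dvd_mul_iff_left (pow_ne_zero s hφ)] at h1
    obtain ⟨d, rfl⟩ := h1
    exact ⟨cls N d, cls_mul _ _⟩

theorem cpow_eq (k : ℕ) : cpow e (e * cls N φ) k = e * cls N (φ ^ k) := by
  have h1 : ∀ k, e * e ^ k = e := fun k => by
    induction k with
    | zero => simp
    | succ k ih => rw [pow_succ, ← mul_assoc, ih, h.mul_self]
  rw [cpow, mul_pow, ← mul_assoc, h1, cls_pow]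

theorem isChainComponent (hdvd : φ ^ s ∣ X ^ N - 1) (hφ : Irreducible φ) (hs : 0 < s) :
    IsChainComponent (component N (φ ^ s)) e (e * cls N φ) s := by
  rw [h.component_eq_span hdvd hφ.ne_zero]
  have hid : ∀ a ∈ Ideal.span {e}, e * a = a := by
    intro a ha
    obtain ⟨c, rfl⟩ := Ideal.mem_span_singleton'.mp ha
    linear_combination c * h.mul_self
  refine isChainComponent_of_unit_or_dvd (Ideal.mem_span_singleton_self _) hid
    (Ideal.mul_mem_right _ _ (Ideal.mem_span_singleton_self _)) ?_ ?_ hs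
  · intro x hx
    have hxe := hid x hx
    obtain ⟨p, rfl⟩ := cls_surjective x
    by_cases hp : φ ∣ p
    · left
      obtain ⟨p, rfl⟩ := hp
      rw [← hxe, cls_mul, ← mul_assoc]
      exact Ideal.mul_mem_right _ _ (Ideal.mem_span_singleton_self _)
    · right
      obtain ⟨a, b, hab⟩ := ((hφ.coprime_iff_not_dvd.mpr hp).pow_left (m := s))
      refine ⟨e * cls N b, Ideal.mul_mem_right _ _ (Ideal.mem_span_singleton_self _), ?_⟩
      have h1 : cls N a * cls N φ ^ s + cls N b * cls N p = 1 := by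
        rw [← cls_pow, ← cls_mul, ← cls_mul, ← cls_add, hab, cls_one]
      linear_combination e * h1 - cls N a * h.mul_eq_zero
  · intro k
    rw [h.cpow_eq, h.mul_cls_eq_zero_iff hdvd, pow_dvd_pow_iff hφ.ne_zero hφ.not_isUnit]

/-- The ideal generated by `Γ ^ k` is isomorphic to `F[x] / (φ ^ (s - k))`. -/
theorem card_span_cpow [Finite F] (hdvd : φ ^ s ∣ X ^ N - 1) (hφ : φ ≠ 0) {k : ℕ} (hk : k ≤ s) :
    Nat.card (Ideal.span {cpow e (e * cls N φ) k}) =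
      (Nat.card F ^ φ.natDegree) ^ (s - k) := by
  let L : F[X] →ₗ[F] CyclicRing F N :=
    (LinearMap.mulLeft F (e * cls N (φ ^ k))).comp (Ideal.Quotient.mkₐ F _).toLinearMap
  have hL : ∀ p, L p = e * cls N (φ ^ k) * cls N p := fun _ => rfl
  have hker : LinearMap.ker L = (Ideal.span {φ ^ (s - k)}).restrictScalars F := by
    ext p
    rw [LinearMap.mem_ker, hL, mul_assoc, ← cls_mul, h.mul_cls_eq_zero_iff hdvd,
      Submodule.restrictScalars_mem, Ideal.mem_span_singleton, ← Nat.add_sub_cancel' hk, pow_add,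
      mul_dvd_mul_iff_left (pow_ne_zero k hφ), Nat.add_sub_cancel_left]
  have hrange : ∀ x, x ∈ Ideal.span {cpow e (e * cls N φ) k} ↔ x ∈ LinearMap.range L := by
    intro x
    rw [h.cpow_eq, Ideal.mem_span_singleton']
    constructor
    · rintro ⟨c, rfl⟩
      obtain ⟨p, rfl⟩ := cls_surjective c
      exact ⟨p, by rw [hL, mul_comm]⟩
    · rintro ⟨p, rfl⟩
      exact ⟨cls N p, by rw [hL, mul_comm]⟩
  have hne : φ ^ (s - k) ≠ 0 := pow_ne_zero _ hφ
  have h1 : Nat.card (Ideal.span {cpow e (e * cls N φ) k}) =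
      Nat.card (F[X] ⧸ Ideal.span {φ ^ (s - k)}) := by
    rw [Nat.card_congr (Equiv.subtypeEquivRight hrange),
      ← Nat.card_congr L.quotKerEquivRange.toEquiv, hker]
    rfl
  have : Module.Finite F (F[X] ⧸ Ideal.span {φ ^ (s - k)}) :=
    (AdjoinRoot.powerBasis hne).finite
  rw [h1, Module.natCard_eq_pow_finrank (K := F), finrank_quotient_span_eq_natDegree,
    natDegree_pow, ← pow_mul, mul_comm]

end IsPrimaryIdempotent

/-- The idempotents of pairwise coprime factors with product `x ^ N - 1` add up to `1`. -/
theorem completeOrthogonalIdempotents {ι : Type*} [Fintype ι] {φ : ι → F[X]}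
    {e : ι → CyclicRing F N} (h : ∀ k, IsPrimaryIdempotent (φ k) s (e k))
    (hco : Pairwise fun j k => IsCoprime (φ j) (φ k)) (hprod : X ^ N - 1 ∣ ∏ k, φ k ^ s) :
    CompleteOrthogonalIdempotents e := by
  have ho : OrthogonalIdempotents e :=
    ⟨fun k => (h k).mul_self, fun j k hjk => (h j).mul_eq_zero_of_isCoprime (h k) (hco hjk)⟩
  refine ⟨ho, ?_⟩
  have h1 : ∏ k, cls N (φ k) ^ s ∣ ∏ k, (1 - e k) :=
    Finset.prod_dvd_prod_of_dvd _ _ fun k _ => (h k).dvd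
  have h2 : ∏ k, cls N (φ k) ^ s = 0 := by
    rw [← cls_eq_zero_iff] at hprod
    rw [← hprod, cls, map_prod]
    rfl
  rw [h2, zero_dvd_iff] at h1
  have h3 : ∏ k, (1 - e k) = 1 - ∑ k, e k := by
    classical
    have key : ∀ t : Finset ι, ∏ k ∈ t, (1 - e k) = 1 - ∑ k ∈ t, e k := by
      intro t
      induction t using Finset.induction_on with
      | empty => simp
      | insert j t hj ih =>
        rw [Finset.prod_insert hj, Finset.sum_insert hj, ih]
        have h0 : e j * ∑ k ∈ t, e k = 0 := by
          rw [Finset.mul_sum]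
          exact Finset.sum_eq_zero fun k hk => ho.ortho (by rintro rfl; exact hj hk)
        linear_combination h0
    exact key _
  rw [h3, sub_eq_zero] at h1
  exact h1.symm

end Primary

/-! ### Factors of `x ^ n - 1` -/

section Factors

variable {F : Type*} [Field F]

theorem irreducible_reverse {g : F[X]} (hg : Irreducible g) (h0 : g.coeff 0 ≠ 0) :
    Irreducible g.reverse := by
  have hrr : ∀ p : F[X], p.coeff 0 ≠ 0 → p.reverse.natDegree = p.natDegree ∧
      p.reverse.reverse = p := by
    intro p hp
    have hd : p.reverse.natDegree = p.natDegree := by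
      rw [reverse_natDegree, natTrailingDegree_eq_zero_of_constantCoeff_ne_zero hp, Nat.sub_zero]
    exact ⟨hd, by rw [reverse, hd, reverse, reflect_reflect]⟩
  have hunit : ∀ p : F[X], p.coeff 0 ≠ 0 → IsUnit p.reverse → IsUnit p := by
    intro p hp hu
    rw [isUnit_iff_degree_eq_zero] at hu ⊢
    have h1 := natDegree_eq_of_degree_eq_some hu
    rw [(hrr p hp).1] at h1
    rw [degree_eq_natDegree (by rintro rfl; simp at hp), h1]
    rfl
  constructor
  · exact fun hu => hg.not_isUnit (hunit g h0 hu)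
  · intro a b hab
    have hgab : g = a.reverse * b.reverse := by
      rw [← reverse_mul_of_domain, ← hab, (hrr g h0).2]
    have hc : a.coeff 0 ≠ 0 ∧ b.coeff 0 ≠ 0 := by
      have h1 := congrArg (fun p => coeff p 0) hab
      simp only [coeff_zero_reverse, mul_coeff_zero] at h1
      exact mul_ne_zero_iff.mp (h1 ▸ leadingCoeff_ne_zero.mpr hg.ne_zero)
    exact (hg.isUnit_or_isUnit hgab).imp (hunit a hc.1) (hunit b hc.2)

theorem exists_coprime_cofactor {φ P : F[X]} (hφ : Irreducible φ) (hP : Squarefree P)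
    (hdvd : φ ∣ P) (s : ℕ) : ∃ h, φ ^ s * h = P ^ s ∧ IsCoprime (φ ^ s) h := by
  obtain ⟨k, rfl⟩ := hdvd
  refine ⟨k ^ s, (mul_pow _ _ _).symm, IsCoprime.pow ?_⟩
  exact hφ.coprime_iff_not_dvd.mpr fun hk => hφ.not_isUnit (hP φ (mul_dvd_mul_left φ hk))

theorem pairwise_isCoprime {ι : Type*} [Fintype ι] {φ : ι → F[X]} (hφ : ∀ k, Irreducible (φ k))
    (hP : Squarefree (∏ k, φ k)) : Pairwise fun j k => IsCoprime (φ j) (φ k) := by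
  classical
  intro j k hjk
  refine (hφ j).coprime_iff_not_dvd.mpr fun hd => (hφ j).not_isUnit (hP (φ j) ?_)
  rw [← Finset.mul_prod_erase _ _ (Finset.mem_univ j)]
  exact mul_dvd_mul_left _ (hd.trans (Finset.dvd_prod_of_mem _ (by simp [hjk.symm])))

end Factors

end DihedralCode

end

/-! ### The classification -/

theorem theorem7p3 {F : Type*} [Field F] [Finite F] (p m l n r w : ℕ) (hp : p.Prime)
    (hF : Nat.card F = p ^ m) (hn : Nat.gcd n p = 1)
    (f : Fin r → F[X]) (g : Fin w → F[X])
    (hf : ∀ i, Irreducible (f i)) (hf' : ∀ i, Associated (f i).reverse (f i))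
    (hg : ∀ j, Irreducible (g j)) (hg' : ∀ j, ¬ Associated (g j).reverse (g j))
    (hfg : Associated (X ^ n - 1 : F[X]) ((∏ i, f i) * ∏ j, (g j * (g j).reverse))) :
    ∃ (E : Fin r → DihedralCode.CyclicRing F (p ^ l * n))
      (E₁ E₂ : Fin w → DihedralCode.CyclicRing F (p ^ l * n))
      (Γ : Fin r → DihedralCode.CyclicRing F (p ^ l * n))
      (Γ₁ Γ₂ : Fin w → DihedralCode.CyclicRing F (p ^ l * n)),
      -- the generators of the maximal ideals
      (∀ i, Γ i = E i * DihedralCode.cls (p ^ l * n) (f i)) ∧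
      (∀ j, Γ₁ j = E₁ j * DihedralCode.cls (p ^ l * n) (g j)) ∧
      (∀ j, Γ₂ j = E₂ j * DihedralCode.cls (p ^ l * n) (g j).reverse) ∧
      -- the component rings, their identities, maximal ideals and nilpotency
      (∀ i, DihedralCode.IsChainComponent
        (DihedralCode.component (p ^ l * n) (f i ^ p ^ l)) (E i) (Γ i) (p ^ l)) ∧
      (∀ j, DihedralCode.IsChainComponent
        (DihedralCode.component (p ^ l * n) (g j ^ p ^ l)) (E₁ j) (Γ₁ j) (p ^ l)) ∧
      (∀ j, DihedralCode.IsChainComponent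
        (DihedralCode.component (p ^ l * n) ((g j).reverse ^ p ^ l)) (E₂ j) (Γ₂ j) (p ^ l)) ∧
      -- every left ideal is a direct sum of left ideals of the listed forms
      (∀ C : Ideal (DihedralCode.GroupRing F (p ^ l * n)),
        ∃ D : Fin r ⊕ Fin w → Ideal (DihedralCode.GroupRing F (p ^ l * n)),
          iSupIndep D ∧ (⨆ k, D k) = C ∧
          (∀ i : Fin r,
            (∃ b ≤ p ^ l, D (Sum.inl i) = DihedralCode.idealA1 (E i) (Γ i) b) ∨
            (∃ a b ρ, DihedralCode.ParamA2 (DihedralCode.component (p ^ l * n) (f i ^ p ^ l))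
                (E i) (Γ i) (p ^ l) a b ρ ∧
              D (Sum.inl i) = DihedralCode.idealA2 (E i) (Γ i) a b ρ)) ∧
          (∀ j : Fin w,
            (∃ a c, a ≤ p ^ l ∧ c ≤ p ^ l ∧
              D (Sum.inr j) = DihedralCode.idealB1 (E₁ j) (Γ₁ j) (E₂ j) (Γ₂ j) a c) ∨
            (∃ a b c α, DihedralCode.ParamB2 (DihedralCode.component (p ^ l * n) (g j ^ p ^ l))
                (E₁ j) (Γ₁ j) (p ^ l) a b c α ∧
              D (Sum.inr j) = DihedralCode.idealB2 (E₁ j) (Γ₁ j) (E₂ j) (Γ₂ j) a b c α))) ∧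
      -- the cardinalities of the left ideals of the listed forms
      (∀ i, ∀ b ≤ p ^ l, Nat.card (DihedralCode.idealA1 (E i) (Γ i) b) =
        p ^ (2 * m * (f i).natDegree * (p ^ l - b))) ∧
      (∀ i a b ρ, DihedralCode.ParamA2 (DihedralCode.component (p ^ l * n) (f i ^ p ^ l))
          (E i) (Γ i) (p ^ l) a b ρ →
        Nat.card (DihedralCode.idealA2 (E i) (Γ i) a b ρ) =
          p ^ (m * (f i).natDegree * (2 * p ^ l - (a + b)))) ∧
      (∀ j a c, a ≤ p ^ l → c ≤ p ^ l →
        Nat.card (DihedralCode.idealB1 (E₁ j) (Γ₁ j) (E₂ j) (Γ₂ j) a c) =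
          p ^ (2 * m * (g j).natDegree * (2 * p ^ l - (a + c)))) ∧
      (∀ j a b c α, DihedralCode.ParamB2 (DihedralCode.component (p ^ l * n) (g j ^ p ^ l))
          (E₁ j) (Γ₁ j) (p ^ l) a b c α →
        Nat.card (DihedralCode.idealB2 (E₁ j) (Γ₁ j) (E₂ j) (Γ₂ j) a b c α) =
          p ^ (2 * m * (g j).natDegree * (2 * p ^ l - (a + c)))) := by
  have : Fact p.Prime := ⟨hp⟩
  have hn0 : n ≠ 0 := by
    rintro rfl
    exact hp.ne_one (by simpa using hn)
  have : NeZero (p ^ l * n) := ⟨mul_ne_zero (pow_ne_zero _ hp.ne_zero) hn0⟩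
  have hs : 0 < p ^ l := pow_pos hp.pos l
  have : CharP F p := by
    have : Fintype F := Fintype.ofFinite F
    exact charP_of_card_eq_prime_pow (by rw [← Nat.card_eq_fintype_card]; exact hF)
  -- the irreducible factors of `x ^ n - 1` as one family
  let φ : Fin r ⊕ (Fin w ⊕ Fin w) → F[X] := Sum.elim f (Sum.elim g fun j => (g j).reverse)
  have hφP : Associated (X ^ n - 1 : F[X]) (∏ k, φ k) := by
    rw [Fintype.prod_sum_type, Fintype.prod_sum_type]
    rwa [Finset.prod_mul_distrib] at hfg
  have hnF : (n : F) ≠ 0 := by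
    rw [Ne, CharP.cast_eq_zero_iff F p]
    exact fun hpn => hp.ne_one (Nat.eq_one_of_dvd_one (hn ▸ Nat.dvd_gcd hpn dvd_rfl))
  have hsqf : Squarefree (X ^ n - 1 : F[X]) :=
    (X_pow_sub_one_separable_iff.mpr hnF).squarefree
  have hφdvd : ∀ k, φ k ∣ X ^ n - 1 := fun k =>
    (Finset.dvd_prod_of_mem φ (Finset.mem_univ k)).trans hφP.symm.dvd
  have hg0 : ∀ j, (g j).coeff 0 ≠ 0 := fun j h0 => by
    obtain ⟨q, hq⟩ := hφdvd (Sum.inr (Sum.inl j))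
    have h1 := congrArg (fun P => coeff P 0) hq
    simp [φ, mul_coeff_zero, h0, hn0.symm] at h1
  have hφirr : ∀ k, Irreducible (φ k) := by
    rintro (i | j | j)
    exacts [hf i, hg j, DihedralCode.irreducible_reverse (hg j) (hg0 j)]
  have hco := DihedralCode.pairwise_isCoprime hφirr (hφP.squarefree_iff.mp hsqf)
  have hN : (X ^ (p ^ l * n) - 1 : F[X]) = (X ^ n - 1) ^ p ^ l := by
    rw [sub_pow_char_pow, one_pow, ← pow_mul, mul_comm]
  have hdvd : ∀ k, φ k ^ p ^ l ∣ X ^ (p ^ l * n) - 1 := fun k =>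
    hN ▸ pow_dvd_pow_of_dvd (hφdvd k) _
  have hprod : (X ^ (p ^ l * n) - 1 : F[X]) ∣ ∏ k, φ k ^ p ^ l := by
    rw [hN, Finset.prod_pow]
    exact pow_dvd_pow_of_dvd hφP.dvd _
  have hex : ∀ k, ∃ e : DihedralCode.CyclicRing F (p ^ l * n),
      DihedralCode.IsPrimaryIdempotent (φ k) (p ^ l) e := fun k => by
    obtain ⟨q, hq, hcoq⟩ := DihedralCode.exists_coprime_cofactor (hφirr k) hsqf (hφdvd k) (p ^ l)
    exact DihedralCode.exists_isPrimaryIdempotent (hq.trans hN.symm) hcoq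
  choose e he using hex
  have hchain := fun k => (he k).isChainComponent (hdvd k) (hφirr k) hs
  have hcard := fun k {b : ℕ} (hb : b ≤ p ^ l) =>
    (he k).card_span_cpow (hdvd k) (hφirr k).ne_zero hb
  have hcomplete := DihedralCode.completeOrthogonalIdempotents he hco hprod
  -- the action of `x ↦ x⁻¹` on the idempotents and on the generators of the maximal ideals
  have hθf : ∀ i, DihedralCode.theta (e (Sum.inl i)) = e (Sum.inl i) := fun i =>
    (he (Sum.inl i)).theta_eq ((he (Sum.inl i)).of_associated (hf' i).symm)
  have hθg : ∀ j, DihedralCode.theta (e (Sum.inr (Sum.inl j))) = e (Sum.inr (Sum.inr j)) :=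
    fun j => (he (Sum.inr (Sum.inl j))).theta_eq (he (Sum.inr (Sum.inr j)))
  have hθg' : ∀ j, DihedralCode.theta (e (Sum.inr (Sum.inr j))) = e (Sum.inr (Sum.inl j)) :=
    fun j => by rw [← hθg, DihedralCode.theta_theta]
  have huf : ∀ i, ∃ u : (DihedralCode.CyclicRing F (p ^ l * n))ˣ,
      DihedralCode.theta (e (Sum.inl i) * DihedralCode.cls (p ^ l * n) (f i)) =
        u * (e (Sum.inl i) * DihedralCode.cls (p ^ l * n) (f i)) := fun i => by
    obtain ⟨u, hu⟩ := DihedralCode.exists_theta_cls (N := p ^ l * n) (f i)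
    obtain ⟨v, hv⟩ := (hf' i).symm
    refine ⟨u * Units.map (Ideal.Quotient.mk _).toMonoidHom v, ?_⟩
    rw [map_mul, hθf, hu, ← hv, DihedralCode.cls_mul]
    change _ = (u : DihedralCode.CyclicRing F (p ^ l * n)) *
      DihedralCode.cls (p ^ l * n) (v : F[X]) * _
    ring
  have hug : ∀ j, ∃ u : (DihedralCode.CyclicRing F (p ^ l * n))ˣ,
      DihedralCode.theta (e (Sum.inr (Sum.inr j)) * DihedralCode.cls (p ^ l * n) (g j).reverse) =
        u * (e (Sum.inr (Sum.inl j)) * DihedralCode.cls (p ^ l * n) (g j)) := fun j => by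
    obtain ⟨u, hu⟩ := DihedralCode.exists_theta_cls (N := p ^ l * n) (g j)
    have h1 := congrArg DihedralCode.theta hu
    rw [DihedralCode.theta_theta, map_mul] at h1
    refine ⟨(Units.map (DihedralCode.theta (F := F) (N := p ^ l * n) :
      _ →* DihedralCode.CyclicRing F (p ^ l * n)) u)⁻¹, ?_⟩
    rw [Units.eq_inv_mul_iff_mul_eq, map_mul, hθg', h1]
    change DihedralCode.theta (u : DihedralCode.CyclicRing F (p ^ l * n)) * _ = _
    ring
  choose uf huf using huf
  choose ug hug using hug
  have h12 : ∀ j, e (Sum.inr (Sum.inl j)) * e (Sum.inr (Sum.inr j)) = 0 := fun j =>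
    hcomplete.ortho (by simp)
  -- the idempotents invariant under `x ↦ x⁻¹`
  have hε : CompleteOrthogonalIdempotents
      (Sum.elim (fun i => e (Sum.inl i))
        fun j => e (Sum.inr (Sum.inl j)) + e (Sum.inr (Sum.inr j))) := by
    refine ⟨⟨?_, ?_⟩, ?_⟩
    · rintro (i | j)
      · exact hcomplete.idem _
      · have h1 := (hcomplete.idem (Sum.inr (Sum.inl j))).eq
        have h2 := (hcomplete.idem (Sum.inr (Sum.inr j))).eq
        change (_ + _) * (_ + _) = _ + _
        linear_combination h1 + h2 + 2 * h12 j
    · rintro (i | j) (i' | j') hne <;>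
        simp only [Sum.elim_inl, Sum.elim_inr, mul_add, add_mul] <;>
        simp only [ne_eq, Sum.inl.injEq, Sum.inr.injEq, reduceCtorEq, not_false_eq_true] at hne <;>
        simp [hcomplete.mul_eq, hne]
    · rw [← hcomplete.complete]
      simp [Fintype.sum_sum_type, Finset.sum_add_distrib]
  have hdeg : ∀ d b, ((p ^ m) ^ d) ^ b = p ^ (m * d * b) := fun d b => by
    rw [← pow_mul, ← pow_mul, mul_assoc]
  refine ⟨fun i => e (Sum.inl i), fun j => e (Sum.inr (Sum.inl j)),
    fun j => e (Sum.inr (Sum.inr j)), _, _, _, fun i => rfl, fun j => rfl, fun j => rfl,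
    fun i => hchain (Sum.inl i), fun j => hchain (Sum.inr (Sum.inl j)),
    fun j => hchain (Sum.inr (Sum.inr j)), ?_, ?_, ?_, ?_, ?_⟩
  · intro C
    obtain ⟨D, hD, hDC, hfix⟩ := DihedralCode.exists_direct_sum hε (by
      rintro (i | j)
      · exact hθf i
      · change DihedralCode.theta (_ + _) = _ + _
        rw [map_add, hθg, hθg', add_comm]) C
    refine ⟨D, hD, hDC, fun i => ?_, fun j => ?_⟩
    · obtain ⟨a, b, ρ, hab, hb, hρ, hnorm, hDi⟩ := DihedralCode.exists_eq_idealA2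
        (hchain (Sum.inl i)) (hθf i) (huf i) (hfix (Sum.inl i))
      rcases hab.eq_or_lt with rfl | hlt
      · exact Or.inl ⟨a, hb, hDi.trans (DihedralCode.idealA2_self (hθf i) (huf i) a ρ)⟩
      · exact Or.inr ⟨a, b, ρ, ⟨hlt, hb, hρ, hnorm⟩, hDi⟩
    · exact DihedralCode.exists_eq_idealB (hchain (Sum.inr (Sum.inl j))) (hθg j) (hθg' j) (h12 j)
        (hug j) (hfix (Sum.inr j))
  · intro i b hb
    have hb' := hcard (Sum.inl i) hb
    rw [hF, hdeg] at hb'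
    rw [← DihedralCode.idealA2_self (hθf i) (huf i) b 0]
    refine (DihedralCode.card_idealA2 (hchain (Sum.inl i)) (hθf i) (huf i) le_rfl ?_).trans ?_
    · rw [Nat.sub_self, DihedralCode.cpow, pow_zero, mul_one, zero_mul, zero_sub]
      exact (Ideal.neg_mem_iff _).mpr (Ideal.mem_span_singleton_self _)
    · refine (congrArg₂ (· * ·) hb' hb').trans ?_
      rw [← pow_add, ← two_mul, ← mul_assoc, ← mul_assoc]
      rfl
  · intro i a b ρ hp2
    have ha := hcard (Sum.inl i) (hp2.lt.le.trans hp2.le)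
    have hb := hcard (Sum.inl i) hp2.le
    rw [hF, hdeg] at ha hb
    refine (DihedralCode.card_idealA2 (hchain (Sum.inl i)) (hθf i) (huf i) hp2.lt.le
      hp2.norm_eq).trans ?_
    refine (congrArg₂ (· * ·) ha hb).trans ?_
    rw [← pow_add, ← mul_add]
    have := hp2.lt
    have := hp2.le
    congr 2
    omega
  · intro j a c ha hc
    have hca := hcard (Sum.inr (Sum.inl j)) ha
    have hcc := hcard (Sum.inr (Sum.inl j)) hc
    rw [hF, hdeg] at hca hcc
    refine (DihedralCode.card_idealB1 (hchain (Sum.inr (Sum.inl j))) (hθg j) (hθg' j) (h12 j)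
      (hug j) a c).trans ?_
    refine (congrArg₂ (fun x z => (x * z) ^ 2) hca hcc).trans ?_
    rw [← pow_add, ← mul_add, ← pow_mul, mul_comm _ 2, ← mul_assoc, ← mul_assoc]
    congr 2
    omega
  · intro j a b c α hp2
    have hca := hcard (Sum.inr (Sum.inl j)) hp2.a_lt.le
    have hcc := hcard (Sum.inr (Sum.inl j)) hp2.c_le
    rw [hF, hdeg] at hca hcc
    refine (DihedralCode.card_idealB2 (hchain (Sum.inr (Sum.inl j))) (hθg j) (hθg' j) (h12 j)
      (hug j) hp2).trans ?_
    refine (congrArg₂ (fun x z => (x * z) ^ 2) hca hcc).trans ?_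
    rw [← pow_add, ← mul_add, ← pow_mul, mul_comm _ 2, ← mul_assoc, ← mul_assoc]
    have := hp2.a_lt
    have := hp2.c_le
    congr 2
    omega
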